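/- **Data model.** Let $L,N,M\ge 1$, $p\in(0,1]$, $\sigma\ge 0$. For $\ell\in\{1,\dots,L\}$ let $s_\ell:[0,1)\to[0,\infty)$ be a continuous power spectral density (PSD) with $\int_0^1 s_\ell(f)\,df=1$ whose autocorrelation function $r_\ell[m]=\int_0^1 s_\ell(f)e^{\mathrm i2\pi fm}\,df$, $m\in\mathbb Z$, is absolutely summable. Model $\ell$ is the process $\check X_\ell[m]=U_\ell[m]\,(X_\ell[m]+W_\ell[m])$, $m\in\mathbb Z$, where $U_\ell$ is i.i.d. Bernoulli with $\mathbb P[U_\ell[m]=1]=p=1-\mathbb P[U_\ell[m]=0]$, $X_\ell$ is a real-valued zero-mean stationary Gaussian process with PSD $s_\ell$, $W_\ell$ is zero-mean white Gaussian noise of variance $\sigma^2$, and $U_\ell,X_\ell,W_\ell$ are mutually independent. The data are observations $x_1,\dots,x_N\in\mathbb R^M$. Each $x_i$ is a contiguous length-$M$ segment of a realization of $\check X_{\ell(i)}$, with every label in $\{1,\dots,L\}$ attained. Different observations may come from different realizations or be (possibly overlapping) segments of the same realization, and no independence between observations is assumed. The true partition is $\mathcal X_\ell=\{x_i:\ell(i)=\ell\}$,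 $\ell=1,\dots,L$ (observations being distinguished by their index). **Distances.** Let $g:\mathbb Z\to\mathbb R$ be even with $g[m]=0$ for $|m|\ge M$, $g[0]=1$, and $0\le\sum_m g[m]e^{-\mathrm i2\pi fm}\le A<\infty$ for all $f\in[0,1)$. Put $\hat g[0]=g[0]/p$ and $\hat g[m]=g[m]/p^2$ for $m\ne0$. The Blackman–Tukey PSD estimate of $x_i$ is $\hat s_i(f)=\sum_{|m|<M}\hat g[m]\,\hat r_i[m]\,e^{-\mathrm i2\pi fm}$ with $\hat r_i[m]=\frac1M\sum_{n=0}^{M-|m|-1}x_i[n+|m|]\,x_i[n]$. Set $d(x_i,x_j)=\frac12\int_0^1|\hat s_i(f)-\hat s_j(f)|\,df$ and $d(X_k,X_\ell)=\frac12\int_0^1|s_k(f)-s_\ell(f)|\,df$. **KM algorithm.** Given $x_1,\dots,x_N$ and $L$: set $c_1=1$; for $q=2,\dots,L$ choose $c_q\in\arg\max_{i}\min_{\ell<q}d(x_i,x_{c_\ell})$; then assign each $x_i$ to a cluster $\hat{\mathcal X}_{\ell^\star}$ with $\ell^\star\in\arg\min_{\ell\in\{1,\dots,L\}}d(x_i,x_{c_\ell})$.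 Ties are broken arbitrarily. **Theorem.** Let $B=\max_\ell\sup_{f\in[0,1)}s_\ell(f)$ and $\mu_{\max}=\max_\ell\sum_{m\in\mathbb Z}|h[m]|\,|r_\ell[m]|$, where $h[m]=1-g[m](1-|m|/M)$ for $|m|<M$ and $h[m]=1$ otherwise. If $$\min_{k\ne\ell}d(X_k,X_\ell)>\frac{8\sqrt2\,A\,\bigl(B+\sigma^2+\sqrt2(1+p)(1+\sigma^2)\bigr)}{p^2}\sqrt{\frac{\log M}{M}}+2\mu_{\max}$$ (a vacuous condition if $L=1$), then with probability at least $1-6N/M^2$ KM succeeds however ties are broken: there is a permutation $\pi$ of $\{1,\dots,L\}$ with $\hat{\mathcal X}_\ell=\mathcal X_{\pi(\ell)}$ for all $\ell$. -/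

import Mathlib

open MeasureTheory ProbabilityTheory
open scoped NNReal

namespace ProcessClustering

noncomputable section

/-! ### Generative models -/

/-- Autocorrelation function `r[m] = ∫₀¹ s(f) e^{2πifm} df` of a process with power spectral
density `s`. -/
def acf (s : ℝ → ℝ) (m : ℤ) : ℂ :=
  ∫ f in (0 : ℝ)..1, (s f : ℂ) * Complex.exp (2 * Real.pi * Complex.I * f * m)

/-- Power spectral densities allowed in the model: non-negative and continuous on `[0,1)`,
normalized to unit power, with absolutely summable autocorrelation function. -/
structure IsNormalizedPSD (s : ℝ → ℝ) : Prop where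
  nonneg : ∀ f ∈ Set.Ico (0 : ℝ) 1, 0 ≤ s f
  continuousOn : ContinuousOn s (Set.Ico 0 1)
  integral_eq_one : ∫ f in (0 : ℝ)..1, s f = 1
  summable_acf : Summable fun m : ℤ => ‖acf s m‖

/-- The distance `d = ½ ∫₀¹ |s(f) - s'(f)| df` between processes with densities `s` and `s'`. -/
def psdDist (s s' : ℝ → ℝ) : ℝ := 1 / 2 * ∫ f in (0 : ℝ)..1, |s f - s' f|

variable {Ω : Type*} [MeasurableSpace Ω]

/-- `Y` is a real-valued zero-mean stationary Gaussian process on `ℤ` with autocorrelation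
function `r`. -/
structure IsStationaryGaussian (P : Measure Ω) (Y : ℤ → Ω → ℝ) (r : ℤ → ℂ) : Prop where
  measurable : ∀ n, Measurable (Y n)
  gaussian : IsGaussianProcess Y P
  mean_zero : ∀ n, ∫ ω, Y n ω ∂P = 0
  correlation : ∀ n m, ((∫ ω, Y (n + m) ω * Y n ω ∂P : ℝ) : ℂ) = r m

/-- `U` is an i.i.d. `{0,1}`-valued process with success probability `p`. -/
structure IsBernoulliProcess (P : Measure Ω) (U : ℤ → Ω → ℝ) (p : ℝ) : Prop where
  measurable : ∀ n, Measurable (U n)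
  indep : iIndepFun U P
  prob_one : ∀ n, P.real {ω | U n ω = 1} = p
  prob_zero : ∀ n, P.real {ω | U n ω = 0} = 1 - p

/-- A realization `(U, X, W)` of a generative model: sampling process `U`, stationary Gaussian
process `X` with density `s`, white Gaussian noise `W` of variance `σ²`, mutually independent. -/
structure IsRealization (P : Measure Ω) (s : ℝ → ℝ) (σ : ℝ≥0) (p : ℝ)
    (U X W : ℤ → Ω → ℝ) : Prop where
  sampling : IsBernoulliProcess P U p
  process : IsStationaryGaussian P X (acf s)
  noise : IsStationaryGaussian P W fun m => if m = 0 then ((σ : ℝ) ^ 2 : ℂ) else 0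
  indep : iIndepFun ![fun ω n => U n ω, fun ω n => X n ω, fun ω n => W n ω] P

/-- `x` is a contiguous length-`M` segment of some realization of `U[m] (X[m] + W[m])`. Different
observations may come from different realizations or be (overlapping) segments of one and the same
realization; no relation between the realizations is imposed. -/
def IsObservation {M : ℕ} (P : Measure Ω) (s : ℝ → ℝ) (σ : ℝ≥0) (p : ℝ)
    (x : Ω → Fin M → ℝ) : Prop :=
  ∃ U X W : ℤ → Ω → ℝ, IsRealization P s σ p U X W ∧
    ∃ t : ℤ, ∀ ω (n : Fin M), x ω n = U (t + n) ω * (X (t + n) ω + W (t + n) ω)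

/-! ### Blackman–Tukey estimation -/

/-- Discrete-time Fourier transform `g(f) = ∑ₘ g[m] e^{-2πifm}`. -/
def dtft (g : ℤ → ℝ) (f : ℝ) : ℂ :=
  ∑' m : ℤ, (g m : ℂ) * Complex.exp (-(2 * Real.pi * Complex.I * f * m))

/-- Even window function supported on `|m| < M`, with `g[0] = 1` and `0 ≤ g(f) ≤ A`
(the transform is real-valued because `g` is even). -/
structure IsWindow (M : ℕ) (A : ℝ) (g : ℤ → ℝ) : Prop where
  even : ∀ m, g (-m) = g m
  support : ∀ m : ℤ, (M : ℤ) ≤ |m| → g m = 0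
  zero : g 0 = 1
  dtft_nonneg : ∀ f ∈ Set.Ico (0 : ℝ) 1, 0 ≤ (dtft g f).re
  dtft_le : ∀ f ∈ Set.Ico (0 : ℝ) 1, (dtft g f).re ≤ A

/-- Bias-corrected window `ĝ[m] = g[m] / u[m]`, where `u[0] = p` and `u[m] = p²` for `m ≠ 0`. -/
def correctedWindow (p : ℝ) (g : ℤ → ℝ) (m : ℤ) : ℝ := g m / if m = 0 then p else p ^ 2

/-- Empirical autocorrelation `r̂[m] = (1/M) ∑_{n=0}^{M-|m|-1} x[n+|m|] x[n]`. -/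
def empiricalACF {M : ℕ} (x : Fin M → ℝ) (m : ℤ) : ℝ :=
  1 / M * ∑ n : Fin M, if h : (n : ℕ) + m.natAbs < M then x ⟨n + m.natAbs, h⟩ * x n else 0

/-- Blackman–Tukey estimate `ŝ(f) = ∑_{m=-M+1}^{M-1} w[m] r̂[m] e^{-2πifm}` with window `w`. -/
def blackmanTukey {M : ℕ} (w : ℤ → ℝ) (x : Fin M → ℝ) (f : ℝ) : ℂ :=
  ∑ m ∈ Finset.Icc (-(M : ℤ) + 1) ((M : ℤ) - 1),
    (w m : ℂ) * empiricalACF x m * Complex.exp (-(2 * Real.pi * Complex.I * f * m))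

/-- Distance `½ ∫₀¹ |ŝ(f) - ŝ'(f)| df` between the estimates computed from two observations. -/
def obsDist {M : ℕ} (w : ℤ → ℝ) (x y : Fin M → ℝ) : ℝ :=
  1 / 2 * ∫ f in (0 : ℝ)..1, ‖blackmanTukey w x f - blackmanTukey w y f‖

/-! ### The KM algorithm -/

/-- `c` and `a` are the cluster centers and the cluster assignment produced by some run of the KM
algorithm on `N` objects with dissimilarities `d`. Ties in the maximization (choice of the next
center) and in the minimization (assignment) may be broken arbitrarily. Indices start at `0`. -/
structure IsKMRun {N L : ℕ} [NeZero N] [NeZero L] (d : Fin N → Fin N → ℝ)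
    (c : Fin L → Fin N) (a : Fin N → Fin L) : Prop where
  first : c 0 = 0
  next : ∀ q : Fin L, q ≠ 0 → ∀ i : Fin N,
    ⨅ l : {l : Fin L // l < q}, d i (c l) ≤ ⨅ l : {l : Fin L // l < q}, d (c q) (c l)
  assign : ∀ (i : Fin N) (l : Fin L), d i (c (a i)) ≤ d i (c l)

/-- KM delivers the correct clustering: whatever the tie-breaking, the inferred partition is the
partition given by `label`, up to the numbering of the clusters. -/
def KMSucceeds {N L : ℕ} [NeZero N] [NeZero L] (d : Fin N → Fin N → ℝ)
    (label : Fin N → Fin L) : Prop :=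
  (∃ (c : Fin L → Fin N) (a : Fin N → Fin L), IsKMRun d c a) ∧
  ∀ (c : Fin L → Fin N) (a : Fin N → Fin L), IsKMRun d c a →
    ∃ π : Equiv.Perm (Fin L), ∀ l, {i | a i = l} = {i | label i = π l}

/-! ### The clustering condition -/

/-- `B = max_ℓ sup_{f ∈ [0,1)} s_ℓ(f)`. -/
def maxPSD {L : ℕ} (s : Fin L → ℝ → ℝ) : ℝ := ⨆ l : Fin L, ⨆ f : Set.Ico (0 : ℝ) 1, s l f

/-- `h[m] = 1 - g[m] (1 - |m|/M)` for `|m| < M`, and `h[m] = 1` otherwise. -/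
def momentWeight (M : ℕ) (g : ℤ → ℝ) (m : ℤ) : ℝ :=
  if |m| < (M : ℤ) then 1 - g m * (1 - |(m : ℝ)| / M) else 1

/-- `μ_max = max_ℓ ∑ₘ |h[m]| |r_ℓ[m]|`. -/
def maxMoment {L : ℕ} (M : ℕ) (g : ℤ → ℝ) (s : Fin L → ℝ → ℝ) : ℝ :=
  ⨆ l : Fin L, ∑' m : ℤ, |momentWeight M g m| * ‖acf (s l) m‖

/-- The clustering condition: all pairs of distinct models satisfy
`d(X_k, X_ℓ) > 8√2 A (B + σ² + √2 (1+p)(1+σ²)) / p² · √(log M / M) + 2 μ_max`. -/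
def ClusteringCondition {L : ℕ} (M : ℕ) (g : ℤ → ℝ) (A : ℝ) (s : Fin L → ℝ → ℝ) (σ : ℝ≥0)
    (p : ℝ) : Prop :=
  ∀ k l : Fin L, k ≠ l →
    8 * √2 * A * (maxPSD s + (σ : ℝ) ^ 2 + √2 * (1 + p) * (1 + (σ : ℝ) ^ 2)) / p ^ 2
        * √(Real.log M / M) + 2 * maxMoment M g s
      < psdDist (s k) (s l)

end

end ProcessClustering

namespace ProcessClustering

/-! Farthest-point clustering is correct once a threshold η separates same-label from
different-label distances: while some label has no center, an observation carrying it is farther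
than η from every center, so the next center has a new label (`kmSucceeds_of_separated`). It
therefore suffices that each estimate is within η of its own noisy density s + σ² in L¹. The
triangle inequality, with the factor 1/2 in the distances, gives at most η within a model and at
least d(X_k, X_ℓ) − η across models, and the condition makes d(X_k, X_ℓ) larger than 2η.

The L¹ error has two parts (`integral_norm_blackmanTukey_sub_le`). Windowing and tapering replace
r[m] by (1 − h[m]) r[m]; since s is the absolutely convergent Fourier series of r on (0,1), this
bias is at most μ_max. The rest is a trigonometric polynomial with coefficients ĝ[m] times the
deviation of r̂[m] from its mean; L¹ ≤ L², Parseval and ∑ g[m]² ≤ A bound it by A D / p² when all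
deviations are at most D.

For D, fix the sampling pattern. Then r̂[m] is a quadratic form in a Gaussian vector, whose matrix
has norm at most 1/M and whose Toeplitz covariance has norm at most B + σ²; diagonalization turns it
into a weighted sum of chi-squared variables, and Chernoff applies
(`measure_abs_empiricalACF_sub_ge_le`). The sampling pattern itself enters through sums of U[n+m]
U[n], which split into two families of independent terms, so that Hoeffding applies
(`measure_abs_sum_lag_gt_le`). Each lag fails with probability at most 6/M³. Union bounds over M
lags and N observations finish the proof, so no joint law of the observations matters. -/

/-! ### The KM algorithm on separated data -/

/-- A run of the KM algorithm always exists: finite maximizations and minimizations are attained. -/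
theorem exists_isKMRun {N L : ℕ} [NeZero N] [NeZero L] (d : Fin N → Fin N → ℝ) :
    ∃ (c : Fin L → Fin N) (a : Fin N → Fin L), IsKMRun d c a := by
  have key : ∀ k : ℕ, ∃ c : Fin L → Fin N, c 0 = 0 ∧ ∀ q : Fin L, q ≠ 0 → (q : ℕ) < k →
      ∀ i : Fin N,
      ⨅ l : {l : Fin L // l < q}, d i (c l) ≤ ⨅ l : {l : Fin L // l < q}, d (c q) (c l) := by
    intro k
    induction k with
    | zero => exact ⟨fun _ => 0, rfl, by simp⟩
    | succ k ih =>
      obtain ⟨c, h0, hc⟩ := ih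
      by_cases hk : ∃ q0 : Fin L, (q0 : ℕ) = k ∧ q0 ≠ 0
      · obtain ⟨q0, hq0, hne⟩ := hk
        obtain ⟨j, hj⟩ := Finite.exists_max fun i : Fin N =>
          ⨅ l : {l : Fin L // l < q0}, d i (c l)
        -- Each infimum for q ≤ k ranges over l < q and never reads the entry at `q0`, so
        -- overwriting that entry keeps the earlier choices optimal.
        have hlt : ∀ q : Fin L, (q : ℕ) ≤ k → ∀ l : {l : Fin L // l < q},
            Function.update c q0 j l = c l := by
          intro q hq l
          apply Function.update_of_ne
          rintro h
          have := Fin.lt_def.1 l.2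
          rw [h] at this
          omega
        refine ⟨Function.update c q0 j, by rw [Function.update_of_ne hne.symm]; exact h0, ?_⟩
        intro q hq hqk i
        simp only [hlt q (by omega)]
        by_cases hqq : q = q0
        · subst hqq
          simpa using hj i
        · rw [Function.update_of_ne hqq]
          have : (q : ℕ) ≠ q0 := fun h => hqq (Fin.ext h)
          exact hc q hq (by omega) i
      · refine ⟨c, h0, fun q hq hqk i => hc q hq ?_ i⟩
        push Not at hk
        have : (q : ℕ) ≠ k := fun h => hq (hk q h)
        omega
  obtain ⟨c, h0, hc⟩ := key L
  choose a ha using fun i : Fin N => Finite.exists_min fun l : Fin L => d i (c l)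
  exact ⟨c, a, h0, fun q hq i => hc q hq q.2 i, ha⟩

/-- KM succeeds as soon as every within-model distance is smaller than every between-model
distance. -/
theorem kmSucceeds_of_separated {N L : ℕ} [NeZero N] [NeZero L] {d : Fin N → Fin N → ℝ}
    {label : Fin N → Fin L} (hlabel : Function.Surjective label) {τ : ℝ}
    (hintra : ∀ i j, label i = label j → d i j ≤ τ)
    (hinter : ∀ i j, label i ≠ label j → τ < d i j) : KMSucceeds d label := by
  refine ⟨exists_isKMRun d, fun c a h => ?_⟩
  -- Fewer than L centers precede q, so some label k is missing, and an observation with that label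
  -- is farther than τ from all of them. Maximality transfers this to `c q`, whereas sharing a label
  -- with `c l` would put it within τ.
  have hnew : ∀ q l : Fin L, l < q → label (c l) ≠ label (c q) := by
    intro q l hlq heq
    have hq0 : q ≠ 0 := fun h => by subst h; exact absurd hlq (Fin.not_lt_zero l)
    obtain ⟨k, hk⟩ : ∃ k, k ∉ (Finset.univ.filter (· < q)).image fun l => label (c l) := by
      by_contra! hall
      have h1 : Fintype.card (Fin L) ≤ ((Finset.univ.filter (· < q)).image
          fun l => label (c l)).card := by
        rw [← Finset.card_univ]
        exact Finset.card_le_card fun k _ => hall k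
      have h2 : (Finset.univ.filter (· < q)).card < Fintype.card (Fin L) := by
        rw [← Finset.card_univ]
        exact Finset.card_lt_card (Finset.filter_ssubset.2 ⟨q, by simp⟩)
      exact absurd (h1.trans Finset.card_image_le) (not_le.2 h2)
    obtain ⟨i, rfl⟩ := hlabel k
    have : Nonempty {l : Fin L // l < q} := ⟨⟨l, hlq⟩⟩
    obtain ⟨l0, hl0⟩ := exists_eq_ciInf_of_finite (f := fun l : {l : Fin L // l < q} => d i (c l))
    have h1 : τ < d i (c l0) := hinter _ _ fun h' => hk (Finset.mem_image.2
      ⟨l0, by simpa using l0.2, h'.symm⟩)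
    have h2 := h.next q hq0 i
    rw [← hl0] at h2
    have h3 : ⨅ l : {l : Fin L // l < q}, d (c q) (c l) ≤ d (c q) (c l) :=
      ciInf_le (Set.finite_range _).bddBelow (⟨l, hlq⟩ : {l : Fin L // l < q})
    have h4 := hintra (c q) (c l) heq.symm
    linarith
  have hinj : Function.Injective fun l => label (c l) := by
    intro l l' hll
    by_contra hne
    rcases lt_or_gt_of_ne hne with hlt | hlt
    · exact hnew _ _ hlt hll
    · exact hnew _ _ hlt hll.symm
  let π : Equiv.Perm (Fin L) := Equiv.ofBijective _ (Finite.injective_iff_bijective.1 hinj)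
  have hπ : ∀ l, π l = label (c l) := fun l => rfl
  have hassign : ∀ i, label i = label (c (a i)) := by
    intro i
    by_contra hne
    obtain ⟨l, hl⟩ := π.surjective (label i)
    exact absurd ((h.assign i l).trans (hintra _ _ (by rw [← hl, hπ]))) (not_le.2 (hinter _ _ hne))
  refine ⟨π, fun l => Set.ext fun i => ?_⟩
  simp only [Set.mem_ofPred_eq, hassign i, ← hπ, π.injective.eq_iff]

/-! ### Tail bounds for quadratic forms in Gaussian vectors -/

theorem integral_exp_mul_sq_sub_one_gaussianReal {x : ℝ} (hx : x < 1 / 2) :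
    ∫ z, Real.exp (x * (z ^ 2 - 1)) ∂gaussianReal 0 1 = Real.exp (-x) * (√(1 - 2 * x))⁻¹ := by
  have hb : 0 < 1 / 2 - x := by linarith
  have h1 : ∀ z : ℝ, gaussianPDFReal 0 1 z • Real.exp (x * (z ^ 2 - 1)) =
      (√(2 * Real.pi))⁻¹ * Real.exp (-x) * Real.exp (-(1 / 2 - x) * z ^ 2) := by
    intro z
    simp only [gaussianPDFReal, smul_eq_mul, NNReal.coe_one, mul_one, sub_zero]
    rw [mul_assoc, mul_assoc, ← Real.exp_add, ← Real.exp_add]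
    congr 2
    ring
  rw [integral_gaussianReal_eq_integral_smul one_ne_zero]
  simp_rw [h1]
  rw [integral_const_mul, integral_gaussian]
  have h2 : Real.pi / (1 / 2 - x) = 2 * Real.pi * (1 - 2 * x)⁻¹ := by
    have : 1 - 2 * x ≠ 0 := by linarith
    field_simp
  rw [h2, Real.sqrt_mul (by positivity : (0 : ℝ) ≤ 2 * Real.pi), Real.sqrt_inv]
  have : √(2 * Real.pi) ≠ 0 := by positivity
  field_simp

/-- A non-integrable function has Bochner integral 0, so the positive closed form already forces
integrability. -/
theorem integrable_exp_mul_sq_sub_one_gaussianReal {x : ℝ} (hx : x < 1 / 2) :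
    Integrable (fun z => Real.exp (x * (z ^ 2 - 1))) (gaussianReal 0 1) := by
  refine not_imp_comm.1 integral_undef ?_
  rw [integral_exp_mul_sq_sub_one_gaussianReal hx]
  have : 0 < √(1 - 2 * x) := Real.sqrt_pos.2 (by linarith)
  positivity

/-- The exponential moments of a centred chi-squared variable are sub-gamma. -/
theorem integral_exp_mul_sq_sub_one_gaussianReal_le {x : ℝ} (hx : x ≤ 1 / 3) :
    ∫ z, Real.exp (x * (z ^ 2 - 1)) ∂gaussianReal 0 1 ≤ Real.exp (6 * x ^ 2) := by
  rw [integral_exp_mul_sq_sub_one_gaussianReal (by linarith)]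
  have hy : 1 / 3 ≤ 1 - 2 * x := by linarith
  have hs : 0 < √(1 - 2 * x) := Real.sqrt_pos.2 (by linarith)
  have h2 : (√(1 - 2 * x))⁻¹ ≤ Real.exp (x + 6 * x ^ 2) := by
    -- Uses log y ≤ y − 1 at y = (1 − 2x)⁻¹, where y − 1 = 2x + 4x²y and y ≤ 3. Only an upper bound
    -- on x enters, so negative weights need no separate treatment.
    have h3 : Real.log ((1 - 2 * x)⁻¹) ≤ 2 * (x + 6 * x ^ 2) := by
      have h4 := Real.log_le_sub_one_of_pos (inv_pos.2 (by linarith : 0 < 1 - 2 * x))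
      have h5 : (1 - 2 * x)⁻¹ - 1 = 2 * x + 4 * x ^ 2 * (1 - 2 * x)⁻¹ := by
        have : 1 - 2 * x ≠ 0 := by linarith
        field_simp
        ring
      have h6 : (1 - 2 * x)⁻¹ ≤ 3 := by
        have := inv_anti₀ (by norm_num) hy
        norm_num at this ⊢
        exact this
      nlinarith [mul_le_mul_of_nonneg_left h6 (sq_nonneg x)]
    rw [Real.log_inv] at h3
    rw [← Real.exp_log hs, ← Real.exp_neg, Real.exp_le_exp, Real.log_sqrt (by linarith)]
    linarith
  calc Real.exp (-x) * (√(1 - 2 * x))⁻¹ ≤ Real.exp (-x) * Real.exp (x + 6 * x ^ 2) := by gcongr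
    _ = Real.exp (6 * x ^ 2) := by rw [← Real.exp_add]; ring_nf

/-- Chernoff's method: the exponential moment factorizes over the independent coordinates, and each
factor is at most exp(6 (θ aᵢ)²). The parameter θ stays free until the size of a is known. -/
theorem measure_sum_mul_sq_sub_one_ge_le {ι : Type*} [Fintype ι] (a : ι → ℝ) {θ t : ℝ}
    (hθ : 0 ≤ θ) (ha : ∀ i, θ * a i ≤ 1 / 3) :
    (Measure.pi fun _ : ι => gaussianReal 0 1).real {z | t ≤ ∑ i, a i * (z i ^ 2 - 1)} ≤
      Real.exp (-θ * t + 6 * θ ^ 2 * ∑ i, a i ^ 2) := by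
  have hprod : ∀ z : ι → ℝ, Real.exp (θ * ∑ i, a i * (z i ^ 2 - 1)) =
      ∏ i, Real.exp (θ * a i * (z i ^ 2 - 1)) := by
    intro z
    rw [← Real.exp_sum, Finset.mul_sum]
    simp_rw [mul_assoc]
  have hint : Integrable (fun z : ι → ℝ => Real.exp (θ * ∑ i, a i * (z i ^ 2 - 1)))
      (Measure.pi fun _ : ι => gaussianReal 0 1) := by
    simp_rw [hprod]
    exact Integrable.fintype_prod (f := fun i (v : ℝ) => Real.exp (θ * a i * (v ^ 2 - 1)))
      fun i => integrable_exp_mul_sq_sub_one_gaussianReal (by linarith [ha i])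
  have hmgf : mgf (fun z : ι → ℝ => ∑ i, a i * (z i ^ 2 - 1))
      (Measure.pi fun _ : ι => gaussianReal 0 1) θ ≤ Real.exp (6 * θ ^ 2 * ∑ i, a i ^ 2) := by
    rw [mgf]
    simp_rw [hprod]
    rw [integral_fintype_prod_eq_prod (f := fun i (v : ℝ) => Real.exp (θ * a i * (v ^ 2 - 1))),
      Finset.mul_sum, Real.exp_sum]
    refine Finset.prod_le_prod (fun i _ => integral_nonneg fun z => (Real.exp_pos _).le)
      fun i _ => ?_
    refine (integral_exp_mul_sq_sub_one_gaussianReal_le (ha i)).trans (le_of_eq ?_)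
    ring_nf
  refine (measure_ge_le_exp_mul_mgf t hθ hint).trans ?_
  rw [Real.exp_add]
  gcongr

theorem dotProduct_mulVec_eq_sum {ι : Type*} [Fintype ι] (A : Matrix ι ι ℝ) (v w : ι → ℝ) :
    v ⬝ᵥ A.mulVec w = ∑ i, ∑ j, A i j * v i * w j := by
  simp only [dotProduct, Matrix.mulVec, Finset.mul_sum]
  exact Finset.sum_congr rfl fun i _ => Finset.sum_congr rfl fun j _ => by ring

open scoped MatrixOrder Matrix.Norms.L2Operator in
/-- A positive semidefinite matrix `C` has a square root `L Lᵀ = C` that diagonalizes a given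
symmetric matrix `K`. -/
theorem exists_mul_transpose_eq_and_diagonal {ι : Type*} [Fintype ι] [DecidableEq ι]
    {C K : Matrix ι ι ℝ} (hC : C.PosSemidef) (hK : K.transpose = K) :
    ∃ (L : Matrix ι ι ℝ) (a : ι → ℝ), L * L.transpose = C ∧
      L.transpose * K * L = Matrix.diagonal a := by
  -- With C = DᵀD, every L = DᵀO with O orthogonal also satisfies LLᵀ = C, so O can be chosen as an
  -- eigenbasis of the symmetric matrix D K Dᵀ.
  obtain ⟨D, hD⟩ := CStarAlgebra.nonneg_iff_eq_star_mul_self.1 hC.nonneg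
  rw [Matrix.star_eq_conjTranspose, Matrix.conjTranspose_eq_transpose_of_trivial] at hD
  have hH : (D * K * D.transpose).IsHermitian := by
    rw [Matrix.IsHermitian, Matrix.conjTranspose_eq_transpose_of_trivial]
    simp [Matrix.transpose_mul, hK, Matrix.mul_assoc]
  let O : Matrix ι ι ℝ := hH.eigenvectorUnitary
  have hO1 : O * O.transpose = 1 := by
    have := Unitary.coe_mul_star_self hH.eigenvectorUnitary
    rwa [Unitary.coe_star, Matrix.star_eq_conjTranspose, Matrix.conjTranspose_eq_transpose_of_trivial] at this
  have hO2 : O.transpose * O = 1 := by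
    have := Unitary.coe_star_mul_self hH.eigenvectorUnitary
    rwa [Matrix.star_eq_conjTranspose, Matrix.conjTranspose_eq_transpose_of_trivial] at this
  obtain ⟨a, hspec⟩ : ∃ a, D * K * D.transpose = O * Matrix.diagonal a * O.transpose := by
    refine ⟨hH.eigenvalues, ?_⟩
    conv_lhs => rw [hH.spectral_theorem]
    simp [Unitary.conjStarAlgAut_apply, Matrix.star_eq_conjTranspose,
      Matrix.conjTranspose_eq_transpose_of_trivial, O]
  refine ⟨D.transpose * O, a, ?_, ?_⟩
  · rw [Matrix.transpose_mul, Matrix.transpose_transpose, hD, Matrix.mul_assoc,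
      ← Matrix.mul_assoc O, hO1, Matrix.one_mul]
  · calc (D.transpose * O).transpose * K * (D.transpose * O)
        = O.transpose * (D * K * D.transpose) * O := by
          simp [Matrix.transpose_mul, Matrix.mul_assoc]
      _ = (O.transpose * O) * Matrix.diagonal a * (O.transpose * O) := by
          rw [hspec]; simp only [Matrix.mul_assoc]
      _ = _ := by rw [hO2]; simp

/-- A centred Gaussian vector with covariance matrix `L Lᵀ` is distributed as `L z` with
standard Gaussian `z`. -/
theorem IsGaussian.eq_map_mulVec {ι : Type*} [Fintype ι] {μ : Measure (ι → ℝ)} [IsGaussian μ]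
    {L : Matrix ι ι ℝ} (hmean : ∀ i, ∫ y, y i ∂μ = 0)
    (hcov : ∀ i j, ∫ y, y i * y j ∂μ = (L * L.transpose) i j) :
    μ = (Measure.pi fun _ : ι => gaussianReal 0 1).map fun z => L.mulVec z := by
  classical
  set γ : Measure (ι → ℝ) := Measure.pi fun _ : ι => gaussianReal 0 1
  have hγ : IsGaussian γ := by
    have h := iIndepFun.hasGaussianLaw (P := γ) (X := fun (i : ι) (z : ι → ℝ) => z i)
      (fun i => ⟨by rw [(measurePreserving_eval _ i).map_eq]; infer_instance⟩)
      (iIndepFun_pi (X := fun (_ : ι) (x : ℝ) => x) fun i => by fun_prop)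
    simpa using h.isGaussian_map
  let Λ : (ι → ℝ) →L[ℝ] (ι → ℝ) := LinearMap.toContinuousLinearMap (Matrix.mulVecLin L)
  have hΛ : (fun z => L.mulVec z) = Λ := by ext; simp [Λ]
  rw [hΛ]
  have hmem : ∀ i, MemLp (fun y : ι → ℝ => y i) 2 μ := fun i =>
    ((IsGaussian.hasGaussianLaw_id (μ := μ)).map_fun (ContinuousLinearMap.proj i)).memLp_two
  -- Both measures are Gaussian, so it is enough that every linear functional has the same mean and
  -- variance under them. This covers singular covariances.
  apply Measure.ext_of_charFunDual
  ext F
  have hF : ∀ y : ι → ℝ, F y = ∑ i, F (Pi.single i 1) * y i := by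
    intro y
    conv_lhs => rw [pi_eq_sum_univ' y]
    simp [map_sum, mul_comm]
  obtain ⟨f, hF⟩ : ∃ f : ι → ℝ, ∀ y : ι → ℝ, F y = ∑ i, f i * y i := ⟨_, hF⟩
  rw [IsGaussian.charFunDual_eq, IsGaussian.charFunDual_eq, variance_map (by fun_prop) (by fun_prop),
    integral_map (by fun_prop) (by fun_prop)]
  have m1 : ∫ y, F y ∂μ = 0 := by
    rw [integral_congr_ae (ae_of_all _ hF)]
    rw [integral_finsetSum _ fun i _ => ((hmem i).integrable one_le_two).const_mul _]
    simp [integral_const_mul, hmean]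
  have m2 : ∫ z, F (Λ z) ∂γ = 0 := by
    have : ∫ z, (F.comp Λ) z ∂γ = 0 := by
      rw [ContinuousLinearMap.integral_comp_id_comm]
      · have h0 : ∫ z, z ∂γ = 0 := by
          ext i
          rw [eval_integral]
          · simp only [Pi.zero_apply]
            have := integral_comp_eval (μ := fun _ : ι => gaussianReal 0 1) (i := i)
              (f := fun x : ℝ => x) (by fun_prop)
            rw [this]; simp
          · exact fun i => ((IsGaussian.hasGaussianLaw_id (μ := γ)).map_fun
              (ContinuousLinearMap.proj i)).integrable
        rw [h0, map_zero]
      · exact IsGaussian.integrable_id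
    simpa using this
  have v1 : Var[F; μ] = ∑ i, (∑ j, L j i * f j) ^ 2 := by
    rw [variance_of_integral_eq_zero (by fun_prop) m1]
    calc ∫ y, F y ^ 2 ∂μ = ∫ y, ∑ i, ∑ j, f i * f j * (y i * y j) ∂μ := by
          congr 1 with y
          rw [hF, sq, Finset.sum_mul_sum]
          exact Finset.sum_congr rfl fun i _ => Finset.sum_congr rfl fun j _ => by ring
      _ = ∑ i, ∑ j, f i * f j * (L * L.transpose) i j := by
          have hi : ∀ i j, Integrable (fun y : ι → ℝ => y i * y j) μ := fun i j =>
            (hmem i).integrable_mul (hmem j)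
          rw [integral_finsetSum _ fun i _ => integrable_finsetSum _ fun j _ =>
            (hi i j).const_mul _]
          refine Finset.sum_congr rfl fun i _ => ?_
          rw [integral_finsetSum _ fun j _ => (hi i j).const_mul _]
          exact Finset.sum_congr rfl fun j _ => by rw [integral_const_mul, hcov]
      _ = _ := by
          simp only [Matrix.mul_apply, Matrix.transpose_apply, Finset.mul_sum]
          have : ∀ i, ∑ j, ∑ k, f i * f j * (L i k * L j k) =
              ∑ k, ∑ j, f i * f j * (L i k * L j k) := fun i => Finset.sum_comm
          simp_rw [this]
          rw [Finset.sum_comm]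
          refine Finset.sum_congr rfl fun k _ => ?_
          rw [sq, Finset.sum_mul_sum]
          exact Finset.sum_congr rfl fun i _ => Finset.sum_congr rfl fun j _ => by ring
  have v2 : Var[F ∘ Λ; γ] = ∑ i, (∑ j, L j i * f j) ^ 2 := by
    have : F ∘ Λ = ∑ i, fun z : ι → ℝ => (∑ j, L j i * f j) * z i := by
      ext z
      simp only [Finset.sum_apply]
      rw [Function.comp_apply, hF]
      simp only [Λ, LinearMap.coe_toContinuousLinearMap', Matrix.mulVecLin_apply, Matrix.mulVec,
        dotProduct, Finset.mul_sum, Finset.sum_mul]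
      rw [Finset.sum_comm]
      exact Finset.sum_congr rfl fun i _ => Finset.sum_congr rfl fun j _ => by
        ring
    rw [this, variance_sum_pi (X := fun i (x : ℝ) => (∑ j, L j i * f j) * x)]
    · refine Finset.sum_congr rfl fun i _ => ?_
      have := variance_const_mul (∑ j, L j i * f j) (id : ℝ → ℝ) (gaussianReal 0 1)
      simpa using this
    · exact fun i => IsGaussian.memLp_two_id.const_mul _
  rw [integral_complex_ofReal, integral_complex_ofReal, m1, m2, v1, v2]

/-- Upper tail of a quadratic form in a centred Gaussian vector whose covariance matrix is bounded
by `S`. -/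
theorem IsGaussian.measure_quadraticForm_ge_le {ι : Type*} [Fintype ι] {μ : Measure (ι → ℝ)}
    [IsGaussian μ] {C K : Matrix ι ι ℝ} {S κ θ t : ℝ}
    (hmean : ∀ i, ∫ y, y i ∂μ = 0) (hcov : ∀ i j, ∫ y, y i * y j ∂μ = C i j)
    (hC : C.PosSemidef) (hCS : ∀ v, v ⬝ᵥ C.mulVec v ≤ S * (v ⬝ᵥ v)) (hK : K.transpose = K)
    (hKκ : ∀ v, |v ⬝ᵥ K.mulVec v| ≤ κ * (v ⬝ᵥ v)) (hκ : 0 ≤ κ) (hS : 0 ≤ S)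
    (hθ : 0 ≤ θ) (hθS : θ * (κ * S) ≤ 1 / 3) :
    μ.real {y | t ≤ y ⬝ᵥ K.mulVec y - (K * C).trace} ≤
      Real.exp (-θ * t + 6 * θ ^ 2 * (κ ^ 2 * S * C.trace)) := by
  classical
  obtain ⟨L, a, hL, hD⟩ := exists_mul_transpose_eq_and_diagonal hC hK
  have hvec : ∀ v, v ⬝ᵥ C.mulVec v = L.transpose.mulVec v ⬝ᵥ L.transpose.mulVec v := by
    intro v
    rw [← hL, ← Matrix.mulVec_mulVec, Matrix.dotProduct_mulVec, Matrix.mulVec_transpose]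
  have hquad : ∀ z, L.mulVec z ⬝ᵥ K.mulVec (L.mulVec z) = ∑ i, a i * z i ^ 2 := by
    intro z
    have : L.mulVec z ⬝ᵥ K.mulVec (L.mulVec z) = z ⬝ᵥ (Matrix.diagonal a).mulVec z := by
      rw [← hD, ← Matrix.mulVec_mulVec, ← Matrix.mulVec_mulVec, Matrix.dotProduct_mulVec z,
        Matrix.vecMul_transpose]
    rw [this]
    simp only [dotProduct, Matrix.mulVec_diagonal]
    exact Finset.sum_congr rfl fun i _ => by ring
  -- The columns of L. A squared column length q satisfies q² ≤ ‖Lᵀlᵢ‖² = lᵢᵀClᵢ ≤ S q, hence q ≤ S,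
  -- and these lengths add up to tr C. Thus |aᵢ| ≤ κS and ∑ aᵢ² ≤ κ² S tr C, the trace replacing the
  -- cruder dimension times S.
  let l : ι → ι → ℝ := fun i => L.mulVec (Pi.single i 1)
  have hl : ∀ i j, l i j = L j i := fun i j => by simp [l]
  have hal : ∀ i, a i = l i ⬝ᵥ K.mulVec (l i) := by
    intro i
    rw [hquad]
    simp [Pi.single_apply]
  have hl2 : ∀ i, 0 ≤ l i ⬝ᵥ l i := fun i => by
    simp only [dotProduct]
    exact Finset.sum_nonneg fun j _ => mul_self_nonneg _
  have hlS : ∀ i, l i ⬝ᵥ l i ≤ S := by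
    intro i
    have h1 := hCS (l i)
    rw [hvec] at h1
    have h2 : L.transpose.mulVec (l i) i = l i ⬝ᵥ l i := by
      simp [Matrix.mulVec, dotProduct, hl]
    have h3 : (l i ⬝ᵥ l i) ^ 2 ≤ L.transpose.mulVec (l i) ⬝ᵥ L.transpose.mulVec (l i) := by
      rw [← h2, sq]
      exact Finset.single_le_sum (f := fun j => L.transpose.mulVec (l i) j *
        L.transpose.mulVec (l i) j) (fun j _ => mul_self_nonneg _) (Finset.mem_univ i)
    by_contra! hlt
    nlinarith [hl2 i]
  have htrC : ∑ i, l i ⬝ᵥ l i = C.trace := by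
    rw [← hL, Matrix.trace_mul_comm]
    simp [Matrix.trace, Matrix.mul_apply, dotProduct, hl]
  have haS : ∀ i, |a i| ≤ κ * (l i ⬝ᵥ l i) := fun i => by rw [hal]; exact hKκ _
  have hsum : ∑ i, a i ^ 2 ≤ κ ^ 2 * S * C.trace := by
    rw [← htrC, Finset.mul_sum]
    refine Finset.sum_le_sum fun i _ => ?_
    calc a i ^ 2 = |a i| ^ 2 := (sq_abs _).symm
      _ ≤ (κ * (l i ⬝ᵥ l i)) ^ 2 := by gcongr; exact haS i
      _ = κ ^ 2 * (l i ⬝ᵥ l i) * (l i ⬝ᵥ l i) := by ring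
      _ ≤ κ ^ 2 * S * (l i ⬝ᵥ l i) := by gcongr; exacts [hl2 i, hlS i]
  have htr : ∑ i, a i = (K * C).trace := by
    rw [← Matrix.trace_diagonal, ← hD, Matrix.trace_mul_comm, ← Matrix.mul_assoc, hL,
      Matrix.trace_mul_comm]
  have hmap := IsGaussian.eq_map_mulVec (L := L) hmean (by simpa [hL] using hcov)
  have hmeas : Measurable fun z : ι → ℝ => L.mulVec z := by
    have : Continuous fun z : ι → ℝ => L.mulVec z := by fun_prop
    exact this.measurable
  rw [hmap, map_measureReal_apply hmeas]
  · have hset : (fun z => L.mulVec z) ⁻¹' {y | t ≤ y ⬝ᵥ K.mulVec y - (K * C).trace} =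
        {z | t ≤ ∑ i, a i * (z i ^ 2 - 1)} := by
      ext z
      simp only [Set.mem_preimage, Set.mem_ofPred_eq, hquad, ← htr, mul_sub, mul_one,
        Finset.sum_sub_distrib]
    rw [hset]
    refine (measure_sum_mul_sq_sub_one_ge_le a (t := t) hθ fun i => ?_).trans ?_
    · refine le_trans ?_ hθS
      have h1 := (le_abs_self _).trans (haS i)
      exact mul_le_mul_of_nonneg_left (h1.trans (mul_le_mul_of_nonneg_left (hlS i) hκ)) hθ
    · gcongr
  · have : Continuous fun y : ι → ℝ => y ⬝ᵥ K.mulVec y - (K * C).trace := by fun_prop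
    exact measurableSet_le measurable_const this.measurable

/-! ### Trigonometric polynomials -/

/-- The character `f ↦ e^{2πifm}`. -/
noncomputable def expi (m : ℤ) (f : ℝ) : ℂ := Complex.exp (2 * Real.pi * Complex.I * f * m)

theorem exp_neg_eq_expi (m : ℤ) (f : ℝ) :
    Complex.exp (-(2 * Real.pi * Complex.I * f * m)) = expi (-m) f := by
  rw [expi]; push_cast; ring_nf

theorem expi_add (m k : ℤ) (f : ℝ) : expi (m + k) f = expi m f * expi k f := by
  rw [expi, expi, expi, ← Complex.exp_add]; push_cast; ring_nf

@[simp] theorem expi_zero (f : ℝ) : expi 0 f = 1 := by simp [expi]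

theorem norm_expi (m : ℤ) (f : ℝ) : ‖expi m f‖ = 1 := by
  have : expi m f = Complex.exp ((2 * Real.pi * f * m : ℝ) * Complex.I) := by
    rw [expi]; push_cast; ring_nf
  rw [this, Complex.norm_exp_ofReal_mul_I]

theorem conj_expi (m : ℤ) (f : ℝ) : (starRingEnd ℂ) (expi m f) = expi (-m) f := by
  rw [expi, expi, ← Complex.exp_conj]
  simp [Complex.conj_ofNat]

@[fun_prop]
theorem continuous_expi (m : ℤ) : Continuous (expi m) := by
  unfold expi; fun_prop

theorem integral_expi (m : ℤ) : ∫ f in (0 : ℝ)..1, expi m f = if m = 0 then 1 else 0 := by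
  split_ifs with h
  · simp [h]
  · have hc : 2 * Real.pi * Complex.I * (m : ℂ) ≠ 0 := by
      simp [h, Real.pi_ne_zero]
    have h1 : ∀ f : ℝ, expi m f = Complex.exp (2 * Real.pi * Complex.I * m * f) := by
      intro f; rw [expi]; ring_nf
    simp_rw [h1]
    rw [integral_exp_mul_complex hc]
    have h2 : Complex.exp (2 * Real.pi * Complex.I * m * (1 : ℝ)) = 1 := by
      rw [← Complex.exp_int_mul_two_pi_mul_I m]; push_cast; ring_nf
    rw [h2]
    simp

/-- Parseval for finite sums. It serves the Toeplitz upper bound, the energy of the window and the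
L² norm of the estimation error. -/
theorem integral_norm_sq_sum_expi {ι : Type*} (F : Finset ι) (k : ι → ℤ) (hk : Set.InjOn k F)
    (c : ι → ℂ) :
    ∫ f in (0 : ℝ)..1, ‖∑ i ∈ F, c i * expi (k i) f‖ ^ 2 = ∑ i ∈ F, ‖c i‖ ^ 2 := by
  have hcast : ((∫ f in (0 : ℝ)..1, ‖∑ i ∈ F, c i * expi (k i) f‖ ^ 2 : ℝ) : ℂ) =
      ((∑ i ∈ F, ‖c i‖ ^ 2 : ℝ) : ℂ) := by
    rw [← intervalIntegral.integral_ofReal]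
    have h1 : ∀ f : ℝ, ((‖∑ i ∈ F, c i * expi (k i) f‖ ^ 2 : ℝ) : ℂ) =
        ∑ i ∈ F, ∑ j ∈ F, c i * (starRingEnd ℂ) (c j) * expi (k i - k j) f := by
      intro f
      rw [Complex.ofReal_pow, ← Complex.mul_conj', map_sum, Finset.sum_mul_sum]
      refine Finset.sum_congr rfl fun i _ => Finset.sum_congr rfl fun j _ => ?_
      rw [map_mul, conj_expi, sub_eq_add_neg, expi_add]
      ring
    simp_rw [h1]
    rw [intervalIntegral.integral_finsetSum fun i _ => by
      apply Continuous.intervalIntegrable; fun_prop]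
    push_cast
    refine Finset.sum_congr rfl fun i hi => ?_
    rw [intervalIntegral.integral_finsetSum fun j _ => by
      apply Continuous.intervalIntegrable; fun_prop]
    simp_rw [intervalIntegral.integral_const_mul, integral_expi, sub_eq_zero]
    rw [Finset.sum_eq_single i]
    · simp [Complex.mul_conj']
    · intro j hj hji
      rw [if_neg, mul_zero]
      exact fun h => hji (hk hj hi h.symm)
    · exact fun h => absurd hi h
  exact_mod_cast hcast

/-- An integrable function on the unit interval whose Fourier coefficients all vanish is zero
almost everywhere. -/
theorem ae_eq_zero_of_integral_expi_mul_eq_zero {h : ℝ → ℂ}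
    (hh : IntervalIntegrable h volume 0 1)
    (hzero : ∀ m, ∫ f in (0 : ℝ)..1, expi m f * h f = 0) :
    ∀ᵐ f, f ∈ Set.Ioo (0 : ℝ) 1 → h f = 0 := by
  have hmul : ∀ φ : C(AddCircle (1 : ℝ), ℂ),
      IntervalIntegrable (fun f : ℝ => φ f * h f) volume 0 1 := fun φ =>
    hh.continuousOn_mul (φ.continuous.comp (AddCircle.continuous_mk' (1 : ℝ))).continuousOn
  -- Integration against h is a bounded functional on continuous periodic functions. It vanishes on
  -- the characters, whose span is dense, hence everywhere.
  let T : C(AddCircle (1 : ℝ), ℂ) →L[ℂ] ℂ := LinearMap.mkContinuous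
    { toFun := fun φ => ∫ f in (0 : ℝ)..1, φ f * h f
      map_add' := fun φ ψ => by
        simp only [ContinuousMap.add_apply, add_mul]
        exact intervalIntegral.integral_add (hmul φ) (hmul ψ)
      map_smul' := fun c φ => by
        simp only [ContinuousMap.smul_apply, smul_eq_mul, mul_assoc, RingHom.id_apply]
        exact intervalIntegral.integral_const_mul _ _ }
    (∫ f in (0 : ℝ)..1, ‖h f‖) fun φ => by
      simp only [LinearMap.coe_mk, AddHom.coe_mk]
      refine (intervalIntegral.norm_integral_le_integral_norm zero_le_one).trans ?_
      rw [mul_comm, ← intervalIntegral.integral_const_mul]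
      refine intervalIntegral.integral_mono_on zero_le_one (hmul φ).norm
        (hh.norm.const_mul _) fun f _ => ?_
      rw [norm_mul]
      gcongr
      exact φ.norm_coe_le_norm _
  have hT : ∀ φ, T φ = ∫ f in (0 : ℝ)..1, φ f * h f := fun φ => rfl
  have hker : ∀ φ, T φ = 0 := by
    have h1 : Submodule.span ℂ (Set.range (@fourier 1)) ≤ LinearMap.ker T.toLinearMap := by
      rw [Submodule.span_le]
      rintro _ ⟨m, rfl⟩
      change T (fourier m) = 0
      rw [hT, ← hzero m]
      refine intervalIntegral.integral_congr fun f _ => ?_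
      simp only [fourier_coe_apply, expi]
      congr 2
      push_cast
      ring
    have h2 := Submodule.topologicalClosure_minimal _ h1 T.isClosed_ker
    rw [span_fourier_closure_eq_top] at h2
    exact fun φ => h2 (Submodule.mem_top (x := φ))
  refine IsOpen.ae_eq_zero_of_integral_contDiff_smul_eq_zero isOpen_Ioo ?_ ?_
  · apply IntegrableOn.locallyIntegrableOn
    rw [intervalIntegrable_iff_integrableOn_Ioo_of_le zero_le_one] at hh
    exact hh
  · intro g hg _ hsupp
    have hout : ∀ x, x ∉ Set.Ioo (0 : ℝ) 1 → g x = 0 := fun x hx =>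
      image_eq_zero_of_notMem_tsupport fun hx' => hx (hsupp hx')
    have h0 : g 0 = 0 := hout 0 (by simp)
    have h1 : g 1 = 0 := hout 1 (by simp)
    -- A test function supported in (0,1) vanishes at both endpoints, so its periodic extension is
    -- continuous and `T` applies to it.
    let φ : C(AddCircle (1 : ℝ), ℂ) := ⟨AddCircle.liftIco 1 0 fun x => (g x : ℂ),
      AddCircle.liftIco_zero_continuous (by simp [h0, h1])
        (Complex.continuous_ofReal.comp hg.continuous).continuousOn⟩
    rw [← hker φ, hT, intervalIntegral.integral_of_le zero_le_one,
      ← integral_Ico_eq_integral_Ioc, ← setIntegral_eq_integral_of_forall_compl_eq_zero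
        (s := Set.Ico (0 : ℝ) 1)]
    · refine setIntegral_congr_fun measurableSet_Ico fun f hf => ?_
      simp only [φ, ContinuousMap.coe_mk]
      rw [AddCircle.liftIco_zero_coe_apply hf]
      simp
    · intro x hx
      rw [hout x fun h => hx ⟨h.1.le, h.2⟩, zero_smul]

/-! ### Autocorrelation functions -/

theorem acf_eq_integral_expi (s : ℝ → ℝ) (m : ℤ) :
    acf s m = ∫ f in (0 : ℝ)..1, expi m f * s f := by
  simp only [acf, expi, mul_comm (s _ : ℂ)]

namespace IsNormalizedPSD

variable {s : ℝ → ℝ}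

/-- Continuity on [0,1) gives no control near 1; integrability comes from the normalization, since a
non-integrable function would have integral 0. -/
theorem intervalIntegrable (hs : IsNormalizedPSD s) : IntervalIntegrable s volume 0 1 := by
  by_contra h
  have := hs.integral_eq_one
  rw [intervalIntegral.integral_undef h] at this
  exact zero_ne_one this

theorem intervalIntegrable_ofReal (hs : IsNormalizedPSD s) :
    IntervalIntegrable (fun f => (s f : ℂ)) volume 0 1 :=
  ⟨hs.intervalIntegrable.1.ofReal, hs.intervalIntegrable.2.ofReal⟩

theorem acf_zero (hs : IsNormalizedPSD s) : acf s 0 = 1 := by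
  have := hs.integral_eq_one
  simp only [acf, Int.cast_zero, mul_zero, Complex.exp_zero, mul_one]
  rw [intervalIntegral.integral_ofReal, this, Complex.ofReal_one]

theorem norm_acf_le (hs : IsNormalizedPSD s) (m : ℤ) : ‖acf s m‖ ≤ 1 := by
  rw [acf_eq_integral_expi]
  refine (intervalIntegral.norm_integral_le_integral_norm zero_le_one).trans
    (le_of_eq (Eq.trans ?_ hs.integral_eq_one))
  simp only [intervalIntegral.integral_of_le zero_le_one, integral_Ioc_eq_integral_Ioo]
  refine setIntegral_congr_fun measurableSet_Ioo fun f hf => ?_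
  simp [norm_expi, abs_of_nonneg (hs.nonneg f ⟨hf.1.le, hf.2⟩)]

theorem summable_acf_mul_expi (hs : IsNormalizedPSD s) (f : ℝ) :
    Summable fun m : ℤ => acf s m * expi (-m) f :=
  Summable.of_norm (by simpa [norm_expi] using hs.summable_acf)

theorem continuous_tsum_acf_mul_expi (hs : IsNormalizedPSD s) :
    Continuous fun f => ∑' m : ℤ, acf s m * expi (-m) f :=
  continuous_tsum (fun m => by fun_prop) hs.summable_acf fun m f => by simp [norm_expi]

/-- The spectral density is the Fourier series of its autocorrelation function. -/
theorem eq_tsum (hs : IsNormalizedPSD s) {f : ℝ} (hf : f ∈ Set.Ioo (0 : ℝ) 1) :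
    (s f : ℂ) = ∑' m : ℤ, acf s m * expi (-m) f := by
  have hint : IntervalIntegrable (fun f => (s f : ℂ)) volume 0 1 := hs.intervalIntegrable_ofReal
  have hcont := hs.continuous_tsum_acf_mul_expi
  have hae := ae_eq_zero_of_integral_expi_mul_eq_zero
    (h := fun f => (s f : ℂ) - ∑' m : ℤ, acf s m * expi (-m) f)
    (hint.sub (hcont.intervalIntegrable _ _)) fun k => by
      simp_rw [mul_sub]
      rw [intervalIntegral.integral_sub
        (hint.continuousOn_mul (continuous_expi k).continuousOn)
        (Continuous.intervalIntegrable (by fun_prop) _ _),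
        ← acf_eq_integral_expi, sub_eq_zero]
      have hsum : HasSum (fun m : ℤ => ∫ f in (0 : ℝ)..1, expi k f * (acf s m * expi (-m) f))
          (∫ f in (0 : ℝ)..1, expi k f * ∑' m : ℤ, acf s m * expi (-m) f) := by
        refine intervalIntegral.hasSum_integral_of_dominated_convergence
          (fun m _ => ‖acf s m‖) (fun m => ?_) (fun m => ?_) ?_ ?_ ?_
        · exact Continuous.aestronglyMeasurable (by fun_prop)
        · exact ae_of_all _ fun f _ => by simp [norm_expi]
        · exact ae_of_all _ fun f _ => hs.summable_acf
        · simp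
        · exact ae_of_all _ fun f _ => (hs.summable_acf_mul_expi f).hasSum.mul_left _
      rw [← hsum.tsum_eq, tsum_eq_single k]
      · simp_rw [mul_left_comm, ← expi_add, intervalIntegral.integral_const_mul, integral_expi]
        simp
      · intro m hm
        simp_rw [mul_left_comm, ← expi_add, intervalIntegral.integral_const_mul, integral_expi]
        rw [if_neg (by omega), mul_zero]
  have heq : Set.EqOn (fun f => (s f : ℂ)) (fun f => ∑' m : ℤ, acf s m * expi (-m) f)
      (Set.Ioo 0 1) := by
    refine Measure.eqOn_open_of_ae_eq (μ := volume) ?_ isOpen_Ioo ?_ hcont.continuousOn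
    · rw [Filter.EventuallyEq, ae_restrict_iff' measurableSet_Ioo]
      filter_upwards [hae] with f h1 h2 using sub_eq_zero.1 (h1 h2)
    · exact Complex.continuous_ofReal.comp_continuousOn
        (hs.continuousOn.mono Set.Ioo_subset_Ico_self)
  exact heq hf

/-- Ensures that the supremum in `maxPSD` is a genuine one. On (0,1) the Fourier series bounds s by
∑ |r[m]|; the point 0 is covered by s(0) itself. -/
theorem bddAbove (hs : IsNormalizedPSD s) :
    BddAbove (Set.range fun f : Set.Ico (0 : ℝ) 1 => s f) := by
  refine ⟨max (s 0) (∑' m : ℤ, ‖acf s m‖), ?_⟩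
  rintro _ ⟨⟨f, hf⟩, rfl⟩
  rcases eq_or_lt_of_le hf.1 with rfl | h0
  · exact le_max_left _ _
  · refine le_trans ?_ (le_max_right _ _)
    have h1 := hs.eq_tsum ⟨h0, hf.2⟩
    have h2 : ‖(s f : ℂ)‖ ≤ ∑' m : ℤ, ‖acf s m‖ := by
      rw [h1]
      refine (norm_tsum_le_tsum_norm ?_).trans (le_of_eq ?_)
      · simpa [norm_expi] using hs.summable_acf
      · simp [norm_expi]
    refine (le_abs_self _).trans ?_
    simpa using h2

end IsNormalizedPSD

theorem le_maxPSD {L : ℕ} {s : Fin L → ℝ → ℝ} (hs : ∀ l, IsNormalizedPSD (s l)) (l : Fin L)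
    {f : ℝ} (hf : f ∈ Set.Ico (0 : ℝ) 1) : s l f ≤ maxPSD s :=
  (le_ciSup (hs l).bddAbove ⟨f, hf⟩).trans
    (le_ciSup (f := fun l : Fin L => ⨆ f : Set.Ico (0 : ℝ) 1, s l f)
      (Set.finite_range _).bddAbove l)

theorem IsNormalizedPSD.one_le_of_le {s : ℝ → ℝ} (hs : IsNormalizedPSD s) {B : ℝ}
    (hB : ∀ f ∈ Set.Ico (0 : ℝ) 1, s f ≤ B) : 1 ≤ B := by
  have : ∫ _ in (0 : ℝ)..1, B = B := by simp
  refine hs.integral_eq_one.ge.trans (le_of_le_of_eq ?_ this)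
  refine intervalIntegral.integral_mono_on_of_le_Ioo zero_le_one hs.intervalIntegrable
    intervalIntegrable_const fun f hf => hB f ⟨hf.1.le, hf.2⟩

/-- The Toeplitz form of the autocorrelation function is the integral of a squared trigonometric
polynomial against the spectral density. -/
theorem sum_mul_acf_sub_eq_integral {ι : Type*} [Fintype ι] {s : ℝ → ℝ} (hs : IsNormalizedPSD s)
    {r : ℤ → ℝ} (hr : ∀ m, acf s m = r m) (k : ι → ℤ) (v : ι → ℝ) :
    ∑ i, ∑ j, r (k i - k j) * v i * v j =
      ∫ f in (0 : ℝ)..1, s f * ‖∑ i, (v i : ℂ) * expi (k i) f‖ ^ 2 := by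
  have hcast : ((∑ i, ∑ j, r (k i - k j) * v i * v j : ℝ) : ℂ) =
      ((∫ f in (0 : ℝ)..1, s f * ‖∑ i, (v i : ℂ) * expi (k i) f‖ ^ 2 : ℝ) : ℂ) := by
    rw [← intervalIntegral.integral_ofReal]
    have hint : IntervalIntegrable (fun f => (s f : ℂ)) volume 0 1 := hs.intervalIntegrable_ofReal
    have h1 : ∀ f : ℝ, ((s f * ‖∑ i, (v i : ℂ) * expi (k i) f‖ ^ 2 : ℝ) : ℂ) =
        ∑ i, ∑ j, (v i : ℂ) * v j * (expi (k i - k j) f * s f) := by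
      intro f
      rw [Complex.ofReal_mul, Complex.ofReal_pow, ← Complex.mul_conj', map_sum,
        Finset.sum_mul_sum, Finset.mul_sum]
      refine Finset.sum_congr rfl fun i _ => ?_
      rw [Finset.mul_sum]
      refine Finset.sum_congr rfl fun j _ => ?_
      rw [map_mul, conj_expi, sub_eq_add_neg, expi_add, Complex.conj_ofReal]
      ring
    have h2 : ∀ i j, IntervalIntegrable
        (fun f => (v i : ℂ) * v j * (expi (k i - k j) f * s f)) volume 0 1 := fun i j =>
      (hint.continuousOn_mul (continuous_expi _).continuousOn).const_mul _
    simp_rw [h1]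
    rw [intervalIntegral.integral_finsetSum fun i _ => by
      have := IntervalIntegrable.sum Finset.univ fun j _ => h2 i j
      simpa [Finset.sum_fn] using this]
    push_cast
    refine Finset.sum_congr rfl fun i _ => ?_
    rw [intervalIntegral.integral_finsetSum fun j _ => h2 i j]
    refine Finset.sum_congr rfl fun j _ => ?_
    rw [intervalIntegral.integral_const_mul, ← acf_eq_integral_expi, hr]
    ring
  exact_mod_cast hcast

theorem sum_mul_acf_sub_nonneg {ι : Type*} [Fintype ι] {s : ℝ → ℝ} (hs : IsNormalizedPSD s)
    {r : ℤ → ℝ} (hr : ∀ m, acf s m = r m) (k : ι → ℤ) (v : ι → ℝ) :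
    0 ≤ ∑ i, ∑ j, r (k i - k j) * v i * v j := by
  rw [sum_mul_acf_sub_eq_integral hs hr, intervalIntegral.integral_of_le zero_le_one,
    ← integral_Ico_eq_integral_Ioc]
  exact setIntegral_nonneg measurableSet_Ico fun f hf =>
    mul_nonneg (hs.nonneg f hf) (sq_nonneg _)

/-- Bound s by B in the integral representation and apply Parseval; injectivity of k keeps the
characters orthonormal. -/
theorem sum_mul_acf_sub_le {ι : Type*} [Fintype ι] {s : ℝ → ℝ} (hs : IsNormalizedPSD s)
    {r : ℤ → ℝ} (hr : ∀ m, acf s m = r m) {k : ι → ℤ} (hk : Function.Injective k) (v : ι → ℝ)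
    {B : ℝ} (hB : ∀ f ∈ Set.Ico (0 : ℝ) 1, s f ≤ B) :
    ∑ i, ∑ j, r (k i - k j) * v i * v j ≤ B * ∑ i, v i ^ 2 := by
  have hpars := integral_norm_sq_sum_expi Finset.univ k hk.injOn fun i => (v i : ℂ)
  simp only [Complex.norm_real, Real.norm_eq_abs, sq_abs] at hpars
  rw [sum_mul_acf_sub_eq_integral hs hr, ← hpars, ← intervalIntegral.integral_const_mul]
  refine intervalIntegral.integral_mono_on_of_le_Ioo zero_le_one ?_ ?_ fun f hf => ?_
  · exact hs.intervalIntegrable.mul_continuousOn (Continuous.continuousOn (by fun_prop))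
  · exact Continuous.intervalIntegrable (by fun_prop) _ _
  · exact mul_le_mul_of_nonneg_right (hB f ⟨hf.1.le, hf.2⟩) (sq_nonneg _)

/-! ### Concentration of the sampling pattern -/

theorem HasSubgaussianMGF.mono {Ω : Type*} [MeasurableSpace Ω] {P : Measure Ω} {X : Ω → ℝ}
    {c c' : ℝ≥0} (h : HasSubgaussianMGF X c P) (hc : c ≤ c') : HasSubgaussianMGF X c' P :=
  ⟨h.integrable_exp_mul, fun t => (h.mgf_le t).trans (by gcongr)⟩

namespace IsBernoulliProcess

variable {Ω : Type*} [MeasurableSpace Ω] {P : Measure Ω} [IsProbabilityMeasure P]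
  {U : ℤ → Ω → ℝ} {p : ℝ}

theorem prob_le_one (hU : IsBernoulliProcess P U p) : p ≤ 1 := by
  rw [← hU.prob_one 0]
  exact measureReal_le_one

theorem ae_eq_zero_or_one (hU : IsBernoulliProcess P U p) (n : ℤ) :
    ∀ᵐ ω ∂P, U n ω = 0 ∨ U n ω = 1 := by
  have h0 : MeasurableSet {ω | U n ω = 0} := hU.measurable n (measurableSet_singleton 0)
  have h1 : MeasurableSet {ω | U n ω = 1} := hU.measurable n (measurableSet_singleton 1)
  have hd : Disjoint {ω | U n ω = 0} {ω | U n ω = 1} := by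
    rw [Set.disjoint_left]
    intro ω ha hb
    simp only [Set.mem_ofPred_eq] at ha hb
    rw [ha] at hb
    exact zero_ne_one hb
  have hu : P.real ({ω | U n ω = 0} ∪ {ω | U n ω = 1}) = 1 := by
    rw [measureReal_union hd h1, hU.prob_zero, hU.prob_one]
    ring
  have := (prob_compl_eq_zero_iff (μ := P) (h0.union h1)).2 (by
    rwa [measureReal_def, ENNReal.toReal_eq_one_iff] at hu)
  filter_upwards [measure_eq_zero_iff_ae_notMem.1 this] with ω hω
  simpa [or_iff_not_imp_left] using hω

theorem integral_eq (hU : IsBernoulliProcess P U p) (n : ℤ) : ∫ ω, U n ω ∂P = p := by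
  have h1 : MeasurableSet {ω | U n ω = 1} := hU.measurable n (measurableSet_singleton 1)
  have : U n =ᵐ[P] {ω | U n ω = 1}.indicator 1 := by
    filter_upwards [hU.ae_eq_zero_or_one n] with ω hω
    rcases hω with h | h <;> simp [h]
  rw [integral_congr_ae this, integral_indicator_one h1, hU.prob_one]

theorem ae_mul_mem_Icc (hU : IsBernoulliProcess P U p) (n k : ℤ) :
    ∀ᵐ ω ∂P, U n ω * U k ω ∈ Set.Icc (0 : ℝ) 1 := by
  filter_upwards [hU.ae_eq_zero_or_one n, hU.ae_eq_zero_or_one k] with ω h1 h2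
  rcases h1 with h1 | h1 <;> rcases h2 with h2 | h2 <;> simp [h1, h2]

theorem integral_mul_eq (hU : IsBernoulliProcess P U p) (n k : ℤ) :
    ∫ ω, U n ω * U k ω ∂P = if n = k then p else p ^ 2 := by
  split_ifs with h
  · subst h
    rw [← hU.integral_eq n]
    apply integral_congr_ae
    filter_upwards [hU.ae_eq_zero_or_one n] with ω hω
    rcases hω with h | h <;> simp [h]
  · rw [(hU.indep.indepFun h).integral_fun_mul_eq_mul_integral
      (hU.measurable n).aestronglyMeasurable (hU.measurable k).aestronglyMeasurable,
      hU.integral_eq, hU.integral_eq, sq]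

/-- Products over disjoint index pairs are independent and [0,1]-valued, so Hoeffding's lemma gives
each the variance proxy 1/4 and the proxies add. Allowing i n = j n includes lag 0. -/
theorem hasSubgaussianMGF_sum_mul (hU : IsBernoulliProcess P U p) (G : Finset ℕ) (i j : ℕ → ℤ)
    (hdisj : ∀ a ∈ G, ∀ b ∈ G, a ≠ b → Disjoint ({i a, j a} : Finset ℤ) {i b, j b}) :
    HasSubgaussianMGF
      (fun ω => ∑ n ∈ G, (U (i n) ω * U (j n) ω - if i n = j n then p else p ^ 2))
      (G.card * 4⁻¹) P := by
  induction G using Finset.induction_on with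
  | empty => simp
  | insert a G ha ih =>
    have hG := ih fun b hb c hc => hdisj b (Finset.mem_insert_of_mem hb) c
      (Finset.mem_insert_of_mem hc)
    have hone : HasSubgaussianMGF
        (fun ω => U (i a) ω * U (j a) ω - if i a = j a then p else p ^ 2) 4⁻¹ P := by
      have := hasSubgaussianMGF_of_mem_Icc (μ := P)
        ((hU.measurable (i a)).mul (hU.measurable (j a))).aemeasurable
        (hU.ae_mul_mem_Icc (i a) (j a))
      simp only [Pi.mul_apply, hU.integral_mul_eq] at this
      convert this using 1
      rw [sub_zero, nnnorm_one]
      norm_num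
    let S : Finset ℤ := {i a, j a}
    let T : Finset ℤ := G.biUnion fun b => {i b, j b}
    have hST : Disjoint S T := by
      rw [Finset.disjoint_biUnion_right]
      exact fun b hb => hdisj a (Finset.mem_insert_self a G) b (Finset.mem_insert_of_mem hb)
        fun h => ha (h ▸ hb)
    have hiT : ∀ b ∈ G, i b ∈ T := fun b hb => Finset.mem_biUnion.2 ⟨b, hb, by simp⟩
    have hjT : ∀ b ∈ G, j b ∈ T := fun b hb => Finset.mem_biUnion.2 ⟨b, hb, by simp⟩
    let φ : (S → ℝ) → ℝ := fun x => x ⟨i a, by simp [S]⟩ * x ⟨j a, by simp [S]⟩ -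
      if i a = j a then p else p ^ 2
    let ψ : (T → ℝ) → ℝ := fun x => ∑ b ∈ G.attach,
      (x ⟨i b, hiT b b.2⟩ * x ⟨j b, hjT b b.2⟩ - if i b = j b then p else p ^ 2)
    have hind := (hU.indep.indepFun_finset S T hST hU.measurable).comp
      (φ := φ) (ψ := ψ) (by fun_prop) (by fun_prop)
    have hψ : (ψ ∘ fun ω (k : T) => U k ω) =
        fun ω => ∑ n ∈ G, (U (i n) ω * U (j n) ω - if i n = j n then p else p ^ 2) := by
      ext ω
      exact Finset.sum_attach G fun n => U (i n) ω * U (j n) ω - if i n = j n then p else p ^ 2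
    rw [hψ] at hind
    have hadd := HasSubgaussianMGF.add_of_indepFun hone hG hind
    simp only [Finset.sum_insert ha, Finset.card_insert_of_notMem ha]
    convert hadd using 1
    push_cast
    ring

theorem measure_abs_sum_mul_ge_le (hU : IsBernoulliProcess P U p) (G : Finset ℕ) (i j : ℕ → ℤ)
    (hdisj : ∀ a ∈ G, ∀ b ∈ G, a ≠ b → Disjoint ({i a, j a} : Finset ℤ) {i b, j b})
    {M : ℕ} (hG : G.card ≤ M) {ε : ℝ} (hε : 0 ≤ ε) :
    P.real {ω | ε ≤ |∑ n ∈ G, (U (i n) ω * U (j n) ω - if i n = j n then p else p ^ 2)|} ≤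
      2 * Real.exp (-(2 * ε ^ 2 / M)) := by
  have hsub := HasSubgaussianMGF.mono (c' := M * 4⁻¹)
    (hU.hasSubgaussianMGF_sum_mul G i j hdisj) (by gcongr)
  have hexp : -ε ^ 2 / (2 * ((M * 4⁻¹ : ℝ≥0) : ℝ)) = -(2 * ε ^ 2 / M) := by
    push_cast
    rcases Nat.eq_zero_or_pos M with rfl | hM
    · simp
    · have : (M : ℝ) ≠ 0 := by positivity
      field_simp
      norm_num
  have h1 := hsub.measure_ge_le hε
  have h2 := hsub.neg.measure_ge_le hε
  rw [hexp] at h1 h2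
  rw [two_mul]
  refine (measureReal_mono ?_).trans ((measureReal_union_le _ _).trans (add_le_add h1 h2))
  intro ω hω
  simp only [Set.mem_ofPred_eq, Set.mem_union, Pi.neg_apply] at hω ⊢
  exact le_abs.1 hω

/-- The number of jointly sampled pairs at lag `m` concentrates around its mean. -/
theorem measure_abs_sum_lag_gt_le (hU : IsBernoulliProcess P U p) (t : ℤ) {M : ℕ} (hM : 1 ≤ M)
    (m : ℕ) :
    P.real {ω | 5 / 2 * √(M * Real.log M) < |∑ n ∈ Finset.range (M - m),
      (U (t + n + m) ω * U (t + n) ω - if m = 0 then p else p ^ 2)|} ≤ 4 / (M : ℝ) ^ 3 := by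
  have hMR : (1 : ℝ) ≤ M := by exact_mod_cast hM
  have hlog : 0 ≤ Real.log M := Real.log_nonneg hMR
  -- Half of the allowed deviation, one half per group below; 2 (5/4)² = 25/8 ≥ 3 yields the
  -- exponent 3 log M.
  set τ := 5 / 4 * √(M * Real.log M) with hτ
  have hgroup : ∀ G : Finset ℕ, G ⊆ Finset.range (M - m) →
      (∀ a ∈ G, ∀ b ∈ G, m ≠ 0 → (a / m) % 2 = (b / m) % 2) →
      P.real {ω | τ ≤ |∑ n ∈ G,
        (U (t + n + m) ω * U (t + n) ω - if m = 0 then p else p ^ 2)|} ≤ 2 / (M : ℝ) ^ 3 := by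
    intro G hG hpar
    have h1 := hU.measure_abs_sum_mul_ge_le G (fun n => t + n + m) (fun n => t + n) ?_
      (M := M) ?_ (ε := τ) (by positivity)
    · have hiff : ∀ n : ℕ, t + n + m = t + n ↔ m = 0 := fun n => by omega
      simp only [hiff] at h1
      refine h1.trans ?_
      rw [hτ, mul_pow, Real.sq_sqrt (by positivity)]
      have h2 : Real.exp (-(2 * ((5 / 4) ^ 2 * (M * Real.log M)) / M)) ≤
          Real.exp (-(3 * Real.log M)) := by
        apply Real.exp_le_exp.2
        have : 2 * ((5 / 4 : ℝ) ^ 2 * (M * Real.log M)) / M = 25 / 8 * Real.log M := by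
          field_simp
          ring
        rw [this]
        linarith
      have h3 : Real.exp (-(3 * Real.log M)) = 1 / (M : ℝ) ^ 3 := by
        rw [Real.exp_neg, mul_comm, Real.exp_mul, Real.exp_log (by linarith)]
        norm_num
      rw [h3] at h2
      calc _ ≤ 2 * (1 / (M : ℝ) ^ 3) := by gcongr
        _ = _ := by ring
    · intro a ha b hb hab
      have hne : ∀ a b : ℕ, (m ≠ 0 → (a / m) % 2 = (b / m) % 2) → m ≠ 0 → a ≠ b + m := by
        rintro a b hp hm rfl
        have := hp hm
        rw [Nat.add_div_right _ (Nat.pos_of_ne_zero hm)] at this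
        omega
      rw [Finset.disjoint_left]
      intro x hx hx'
      simp only [Finset.mem_insert, Finset.mem_singleton] at hx hx'
      have h1 := hne a b (hpar a ha b hb)
      have h2 := hne b a (hpar b hb a ha)
      by_cases hm : m = 0
      · omega
      · have := h1 hm; have := h2 hm
        omega
    · exact (Finset.card_le_card hG).trans (by simp)
  set R := Finset.range (M - m)
  -- Shifting n by m flips the parity of ⌊n/m⌋, so within one parity class the pairs {n + m, n} are
  -- disjoint. For m = 0 the convention n / 0 = 0 puts all indices in the even class, and the pairs
  -- are singletons.
  have h1 := hgroup (R.filter fun n => (n / m) % 2 = 0) (Finset.filter_subset _ _) (by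
    intro a ha b hb _
    rw [(Finset.mem_filter.1 ha).2, (Finset.mem_filter.1 hb).2])
  have h2 := hgroup (R.filter fun n => ¬ (n / m) % 2 = 0) (Finset.filter_subset _ _) (by
    intro a ha b hb _
    have := (Finset.mem_filter.1 ha).2
    have := (Finset.mem_filter.1 hb).2
    omega)
  have h4 : (4 : ℝ) / (M : ℝ) ^ 3 = 2 / (M : ℝ) ^ 3 + 2 / (M : ℝ) ^ 3 := by ring
  rw [h4]
  refine (measureReal_mono ?_).trans ((measureReal_union_le _ _).trans (add_le_add h1 h2))
  intro ω hω
  simp only [Set.mem_ofPred_eq, Set.mem_union] at hω ⊢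
  rw [← Finset.sum_filter_add_sum_filter_not R fun n => (n / m) % 2 = 0] at hω
  by_contra! hcon
  have := hω.trans_le (abs_add_le _ _)
  linarith [hcon.1, hcon.2]

end IsBernoulliProcess

/-! ### The empirical autocorrelation as a quadratic form -/

theorem sum_sum_ite_lag {M : ℕ} (m : ℕ) (F : Fin M → Fin M → ℝ) :
    ∑ i : Fin M, ∑ j : Fin M, (if (i : ℕ) = j + m then F i j else 0) =
      ∑ j : Fin M, if h : (j : ℕ) + m < M then F ⟨j + m, h⟩ j else 0 := by
  rw [Finset.sum_comm]
  refine Finset.sum_congr rfl fun j _ => ?_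
  split_ifs with h
  · rw [Finset.sum_eq_single (⟨j + m, h⟩ : Fin M)]
    · simp
    · intro i _ hi
      rw [if_neg fun h' => hi (Fin.ext h')]
    · simp
  · refine Finset.sum_eq_zero fun i _ => if_neg ?_
    have := i.2
    omega

theorem empiricalACF_natCast {M : ℕ} (x : Fin M → ℝ) (m : ℕ) :
    empiricalACF x m =
      1 / M * ∑ i : Fin M, ∑ j : Fin M, if (i : ℕ) = j + m then x i * x j else 0 := by
  rw [empiricalACF, sum_sum_ite_lag m fun i j => x i * x j]
  simp only [Int.natAbs_natCast]

/-- From |ab| ≤ (a² + b²)/2, as each index occurs at most once as leading and once as lagging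
factor. It yields the norm bound 1/M for the lag matrices, uniformly in the lag. -/
theorem abs_empiricalACF_natCast_le {M : ℕ} (x : Fin M → ℝ) (m : ℕ) :
    |empiricalACF x m| ≤ 1 / M * ∑ i, x i ^ 2 := by
  rw [empiricalACF_natCast, abs_mul, abs_of_nonneg (by positivity : (0 : ℝ) ≤ 1 / M)]
  refine mul_le_mul_of_nonneg_left ?_ (by positivity)
  have hcount : ∀ s : Finset (Fin M), (∀ a ∈ s, ∀ b ∈ s, a = b) → ∀ c : ℝ, 0 ≤ c →
      ∑ _j ∈ s, c ≤ c := by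
    intro s hs c hc
    rw [Finset.sum_const, nsmul_eq_mul]
    have : (s.card : ℝ) ≤ 1 := by
      exact_mod_cast Finset.card_le_one.2 fun a ha b hb => hs a ha b hb
    nlinarith
  have h1 : ∀ i : Fin M, ∑ j : Fin M, (if (i : ℕ) = j + m then x i ^ 2 / 2 else 0) ≤
      x i ^ 2 / 2 := by
    intro i
    rw [← Finset.sum_filter]
    refine hcount _ (fun a ha b hb => Fin.ext ?_) _ (by positivity)
    have := (Finset.mem_filter.1 ha).2
    have := (Finset.mem_filter.1 hb).2
    omega
  have h2 : ∀ j : Fin M, ∑ i : Fin M, (if (i : ℕ) = j + m then x j ^ 2 / 2 else 0) ≤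
      x j ^ 2 / 2 := by
    intro j
    rw [← Finset.sum_filter]
    refine hcount _ (fun a ha b hb => Fin.ext ?_) _ (by positivity)
    have := (Finset.mem_filter.1 ha).2
    have := (Finset.mem_filter.1 hb).2
    omega
  calc |∑ i : Fin M, ∑ j : Fin M, if (i : ℕ) = j + m then x i * x j else 0|
      ≤ ∑ i : Fin M, ∑ j : Fin M, |if (i : ℕ) = j + m then x i * x j else 0| :=
        (Finset.abs_sum_le_sum_abs _ _).trans
          (Finset.sum_le_sum fun i _ => Finset.abs_sum_le_sum_abs _ _)
    _ ≤ ∑ i : Fin M, ∑ j : Fin M, ((if (i : ℕ) = j + m then x i ^ 2 / 2 else 0) +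
          if (i : ℕ) = j + m then x j ^ 2 / 2 else 0) := by
        refine Finset.sum_le_sum fun i _ => Finset.sum_le_sum fun j _ => ?_
        split_ifs
        · rw [abs_le]
          constructor <;> nlinarith [sq_nonneg (x i + x j), sq_nonneg (x i - x j)]
        · simp
    _ = ∑ i : Fin M, ∑ j : Fin M, (if (i : ℕ) = j + m then x i ^ 2 / 2 else 0) +
          ∑ j : Fin M, ∑ i : Fin M, if (i : ℕ) = j + m then x j ^ 2 / 2 else 0 := by
        simp only [Finset.sum_add_distrib]
        congr 1
        exact Finset.sum_comm
    _ ≤ ∑ i, x i ^ 2 / 2 + ∑ j, x j ^ 2 / 2 :=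
        add_le_add (Finset.sum_le_sum fun i _ => h1 i) (Finset.sum_le_sum fun j _ => h2 j)
    _ = ∑ i, x i ^ 2 := by
        rw [← Finset.sum_add_distrib]
        exact Finset.sum_congr rfl fun i _ => by ring

/-- The symmetric matrix whose quadratic form is `y ↦ r̂[m]` computed from `u y`. -/
noncomputable def lagMatrix {M : ℕ} (u : Fin M → ℝ) (m : ℕ) : Matrix (Fin M) (Fin M) ℝ :=
  Matrix.of fun i j => 1 / (2 * M) * ((if (i : ℕ) = j + m then u i * u j else 0) +
    if (j : ℕ) = i + m then u j * u i else 0)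

theorem transpose_lagMatrix {M : ℕ} (u : Fin M → ℝ) (m : ℕ) :
    (lagMatrix u m).transpose = lagMatrix u m := by
  ext i j
  simp only [lagMatrix, Matrix.transpose_apply, Matrix.of_apply]
  ring

theorem sum_sum_lagMatrix_mul {M : ℕ} (u : Fin M → ℝ) (m : ℕ) {F : Fin M → Fin M → ℝ}
    (hF : ∀ i j, F i j = F j i) :
    ∑ i, ∑ j, lagMatrix u m i j * F i j =
      1 / M * ∑ i : Fin M, ∑ j : Fin M, if (i : ℕ) = j + m then u i * u j * F i j else 0 := by
  have h1 : ∑ i, ∑ j, lagMatrix u m i j * F i j = 1 / (2 * M) *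
      (∑ i : Fin M, ∑ j : Fin M, (if (i : ℕ) = j + m then u i * u j * F i j else 0) +
       ∑ i : Fin M, ∑ j : Fin M, if (j : ℕ) = i + m then u j * u i * F j i else 0) := by
    rw [← Finset.sum_add_distrib, Finset.mul_sum]
    refine Finset.sum_congr rfl fun i _ => ?_
    rw [← Finset.sum_add_distrib, Finset.mul_sum]
    refine Finset.sum_congr rfl fun j _ => ?_
    rw [lagMatrix, Matrix.of_apply, hF j i, mul_assoc, add_mul, ite_mul, ite_mul, zero_mul]
  rw [h1, Finset.sum_comm (f := fun i j : Fin M =>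
    if (j : ℕ) = i + m then u j * u i * F j i else 0)]
  ring

theorem dotProduct_lagMatrix_mulVec {M : ℕ} (u y : Fin M → ℝ) (m : ℕ) :
    y ⬝ᵥ (lagMatrix u m).mulVec y = empiricalACF (fun i => u i * y i) m := by
  rw [dotProduct_mulVec_eq_sum, empiricalACF_natCast]
  simp_rw [mul_assoc]
  rw [sum_sum_lagMatrix_mul u m (F := fun i j => y i * y j) fun i j => mul_comm _ _]
  refine congrArg _ (Finset.sum_congr rfl fun i _ => Finset.sum_congr rfl fun j _ => ?_)
  congr 1
  ring

/-- For a Toeplitz covariance this trace is the mean of the quadratic form, that is, the conditional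
expectation of r̂[m] given the sampling pattern u. -/
theorem trace_lagMatrix_mul {M : ℕ} (u : Fin M → ℝ) (m : ℕ) {ρ : ℤ → ℝ} (hρ : ∀ k, ρ (-k) = ρ k) :
    (lagMatrix u m * Matrix.of fun i j : Fin M => ρ (i - j)).trace = empiricalACF u m * ρ m := by
  have hF : ∀ i j : Fin M, ρ (j - i) = ρ (i - j) := fun i j => by rw [← hρ, neg_sub]
  simp only [Matrix.trace, Matrix.diag, Matrix.mul_apply, Matrix.of_apply]
  rw [sum_sum_lagMatrix_mul u m (F := fun i j : Fin M => ρ (j - i)) fun i j => hF i j,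
    empiricalACF_natCast, mul_assoc, Finset.sum_mul]
  refine congrArg _ (Finset.sum_congr rfl fun i _ => ?_)
  rw [Finset.sum_mul]
  refine Finset.sum_congr rfl fun j _ => ?_
  rw [ite_mul, zero_mul]
  split_ifs with h
  swap
  · rfl
  rw [hF, h]
  congr 2
  push_cast
  ring

/-! ### Concentration of the empirical autocorrelation for a fixed sampling pattern -/

/-- For Gaussian data with a Toeplitz covariance bounded by `S` and variance `ρ 0`, the empirical
autocorrelation deviates from its mean by at most `(4√2 S + 11/2 ρ 0) √(log M / M)`, up to an
event of probability `2 / M³`. -/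
theorem measure_abs_empiricalACF_sub_ge_le {M : ℕ} (hM : 1 ≤ M) {μ : Measure (Fin M → ℝ)}
    [IsGaussian μ] {ρ : ℤ → ℝ} (hρ : ∀ k, ρ (-k) = ρ k) {S : ℝ} (hS : 1 ≤ S) (hρ0 : 1 ≤ ρ 0)
    (hmean : ∀ i, ∫ y, y i ∂μ = 0)
    (hcov : ∀ i j : Fin M, ∫ y, y i * y j ∂μ = ρ (i - j))
    (hpos : ∀ v : Fin M → ℝ, 0 ≤ ∑ i : Fin M, ∑ j : Fin M, ρ (i - j) * v i * v j)
    (hle : ∀ v : Fin M → ℝ, ∑ i : Fin M, ∑ j : Fin M, ρ (i - j) * v i * v j ≤ S * ∑ i, v i ^ 2)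
    {u : Fin M → ℝ} (hu : ∀ i, |u i| ≤ 1) (m : ℕ) :
    μ.real {y | (4 * √2 * S + 11 / 2 * ρ 0) * √(Real.log M / M) ≤
      |empiricalACF (fun i => u i * y i) m - empiricalACF u m * ρ m|} ≤ 2 / (M : ℝ) ^ 3 := by
  have hMR : (1 : ℝ) ≤ M := by exact_mod_cast hM
  have hlog : 0 ≤ Real.log M := Real.log_nonneg hMR
  set C : Matrix (Fin M) (Fin M) ℝ := Matrix.of fun i j : Fin M => ρ (i - j) with hCdef
  have hquad : ∀ v : Fin M → ℝ, v ⬝ᵥ C.mulVec v = ∑ i : Fin M, ∑ j : Fin M, ρ (i - j) * v i * v j :=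
    fun v => dotProduct_mulVec_eq_sum C v v
  have hdot : ∀ v : Fin M → ℝ, v ⬝ᵥ v = ∑ i, v i ^ 2 := fun v => by simp [dotProduct, sq]
  have hCpsd : C.PosSemidef := by
    refine Matrix.PosSemidef.of_dotProduct_mulVec_nonneg ?_ fun v => ?_
    · ext i j
      simp [C, ← hρ ((i : ℤ) - j)]
    · simpa [hquad] using hpos v
  have htrC : C.trace = M * ρ 0 := by simp [C, Matrix.trace]
  set a := √(Real.log M / M) with ha
  have ha2 : a ^ 2 = Real.log M / M := Real.sq_sqrt (by positivity)
  have ha0 : 0 ≤ a := Real.sqrt_nonneg _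
  -- The factor 27/50 must be at least 3/(4√2) ≈ 0.530, so that the term 4√2 S alone gives 3 log M
  -- in the exponent, and at most (1/3)√(8/3) ≈ 0.544, so that a² ≤ 3/8 implies θκS ≤ 1/3 with κ =
  -- 1/M. The term 11/2 ρ(0) absorbs the quadratic Chernoff term because 27/50 · 11/2 ≥ 6 (27/50)².
  set θ := 27 / 50 * (M * a) / S with hθ
  have hθS : θ * (1 / M * S) ≤ 1 / 3 := by
    have h1 : θ * (1 / M * S) = 27 / 50 * a := by
      rw [hθ]; field_simp
    -- log M ≤ M/e, the tangent bound at e, together with e > 8/3.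
    have h2 : a ^ 2 ≤ 9 / 24 := by
      rw [ha2, div_le_iff₀ (by linarith)]
      have he : (8 / 3 : ℝ) < Real.exp 1 := by have := Real.exp_one_gt_d9; linarith
      have h3 := Real.log_le_sub_one_of_pos (x := M / Real.exp 1) (by positivity)
      rw [Real.log_div (by linarith) (by positivity), Real.log_exp] at h3
      have h4 : (M : ℝ) / Real.exp 1 ≤ M / (8 / 3) := by gcongr
      linarith
    rw [h1]
    nlinarith
  set τ := (4 * √2 * S + 11 / 2 * ρ 0) * a with hτ
  have hexp : -θ * τ + 6 * θ ^ 2 * ((1 / M) ^ 2 * S * (M * ρ 0)) ≤ -(3 * Real.log M) := by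
    have hS0 : 0 < S := by linarith
    have hMa : M * a ^ 2 = Real.log M := by rw [ha2]; field_simp
    have h1 : θ * τ = 27 / 50 * Real.log M * (4 * √2 + 11 / 2 * (ρ 0 / S)) := by
      rw [hθ, hτ, ← hMa]; field_simp
    have h2 : θ ^ 2 * ((1 / M) ^ 2 * S * (M * ρ 0)) =
        (27 / 50) ^ 2 * Real.log M * (ρ 0 / S) := by
      rw [hθ, ← hMa]; field_simp
    have h3 : (1.41 : ℝ) ≤ √2 := Real.le_sqrt_of_sq_le (by norm_num)
    have h4 : 0 ≤ Real.log M * (ρ 0 / S) := by positivity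
    have h5 : Real.log M * 1.41 ≤ Real.log M * √2 := by gcongr
    have h6 : -θ * τ + 6 * θ ^ 2 * ((1 / M) ^ 2 * S * (M * ρ 0)) =
      -(θ * τ) + 6 * (θ ^ 2 * ((1 / M) ^ 2 * S * (M * ρ 0))) := by ring
    rw [h6, h1, h2]
    linarith
  have hM3 : Real.exp (-(3 * Real.log M)) = 1 / (M : ℝ) ^ 3 := by
    rw [Real.exp_neg, mul_comm, Real.exp_mul, Real.exp_log (by linarith)]
    norm_num
  have hK : ∀ v : Fin M → ℝ, |v ⬝ᵥ (lagMatrix u m).mulVec v| ≤ 1 / M * (v ⬝ᵥ v) := by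
    intro v
    rw [dotProduct_lagMatrix_mulVec, hdot]
    refine (abs_empiricalACF_natCast_le _ m).trans ?_
    refine mul_le_mul_of_nonneg_left (Finset.sum_le_sum fun i _ => ?_) (by positivity)
    rw [mul_pow]
    have : u i ^ 2 ≤ 1 := (sq_le_one_iff_abs_le_one _).2 (hu i)
    nlinarith [sq_nonneg (v i)]
  have htail : ∀ K : Matrix (Fin M) (Fin M) ℝ, K.transpose = K →
      (∀ v, |v ⬝ᵥ K.mulVec v| ≤ 1 / M * (v ⬝ᵥ v)) →
      μ.real {y | τ ≤ y ⬝ᵥ K.mulVec y - (K * C).trace} ≤ 1 / (M : ℝ) ^ 3 := by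
    intro K hKt hK'
    refine (IsGaussian.measure_quadraticForm_ge_le (C := C) hmean hcov hCpsd
      (fun v => by rw [hquad, hdot]; exact hle v) hKt hK' (by positivity) (by linarith)
      (by positivity) hθS).trans ?_
    rw [htrC, ← hM3]
    exact Real.exp_le_exp.2 hexp
  have h1 := htail (lagMatrix u m) (transpose_lagMatrix u m) hK
  have h2 := htail (-lagMatrix u m) (by rw [Matrix.transpose_neg, transpose_lagMatrix])
    fun v => by rw [Matrix.neg_mulVec, dotProduct_neg, abs_neg]; exact hK v
  have h3 : (2 : ℝ) / (M : ℝ) ^ 3 = 1 / (M : ℝ) ^ 3 + 1 / (M : ℝ) ^ 3 := by ring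
  rw [h3]
  refine (measureReal_mono ?_).trans ((measureReal_union_le _ _).trans (add_le_add h1 h2))
  intro y hy
  simp only [Set.mem_ofPred_eq, Set.mem_union, Matrix.neg_mulVec, dotProduct_neg,
    Matrix.neg_mul, Matrix.trace_neg, dotProduct_lagMatrix_mulVec, hCdef,
    trace_lagMatrix_mul u m hρ] at hy ⊢
  rcases le_abs.1 hy with h | h
  · exact Or.inl h
  · exact Or.inr (by linarith)

/-! ### Concentration of the empirical autocorrelation of one observation -/

variable {Ω : Type*} [MeasurableSpace Ω] {P : Measure Ω}

namespace IsStationaryGaussian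

variable {Y : ℤ → Ω → ℝ} {r : ℤ → ℂ}

theorem hasGaussianLaw_segment (hY : IsStationaryGaussian P Y r) (t : ℤ) (M : ℕ) :
    HasGaussianLaw (fun ω (n : Fin M) => Y (t + n) ω) P := by
  let I : Finset ℤ := Finset.univ.image fun n : Fin M => t + (n : ℤ)
  have hI : ∀ n : Fin M, t + (n : ℤ) ∈ I := fun n => Finset.mem_image_of_mem _ (Finset.mem_univ n)
  let Λ : (I → ℝ) →L[ℝ] (Fin M → ℝ) :=
    ContinuousLinearMap.pi fun n => ContinuousLinearMap.proj ⟨t + n, hI n⟩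
  exact (hY.gaussian.hasGaussianLaw I).map_fun Λ

theorem memLp_two (hY : IsStationaryGaussian P Y r) (n : ℤ) : MemLp (Y n) 2 P :=
  (hY.gaussian.hasGaussianLaw_eval n).memLp_two

theorem integral_mul_eq (hY : IsStationaryGaussian P Y r) (n k : ℤ) :
    ((∫ ω, Y n ω * Y k ω ∂P : ℝ) : ℂ) = r (n - k) := by
  have := hY.correlation k (n - k)
  rwa [add_sub_cancel] at this

theorem apply_neg (hY : IsStationaryGaussian P Y r) (m : ℤ) : r (-m) = r m := by
  have h1 := hY.integral_mul_eq 0 m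
  have h2 := hY.integral_mul_eq m 0
  simp_rw [mul_comm (Y 0 _)] at h1
  rw [zero_sub] at h1
  rw [sub_zero] at h2
  rw [← h1, ← h2]

/-- A spectral density is not assumed symmetric; its autocorrelation is real because it is the
correlation of a real-valued process. -/
theorem eq_re (hY : IsStationaryGaussian P Y r) (m : ℤ) : r m = ((r m).re : ℂ) := by
  have h := hY.integral_mul_eq m 0
  rw [sub_zero] at h
  rw [← h, Complex.ofReal_re]

end IsStationaryGaussian

/-- Autocorrelation function of the noisy process `X + W`. -/
noncomputable def noisyACF (s : ℝ → ℝ) (σ : ℝ≥0) (m : ℤ) : ℝ :=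
  (acf s m).re + if m = 0 then (σ : ℝ) ^ 2 else 0

namespace IsRealization

variable {s : ℝ → ℝ} {σ : ℝ≥0} {p : ℝ} {U X W : ℤ → Ω → ℝ}

theorem measurable_fun (h : IsRealization P s σ p U X W) (i : Fin 3) :
    Measurable (![fun ω n => U n ω, fun ω n => X n ω, fun ω n => W n ω] i) := by
  fin_cases i
  · exact measurable_pi_lambda _ h.sampling.measurable
  · exact measurable_pi_lambda _ h.process.measurable
  · exact measurable_pi_lambda _ h.noise.measurable

theorem indepFun_process_noise (h : IsRealization P s σ p U X W) :
    IndepFun (fun ω n => X n ω) (fun ω n => W n ω) P :=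
  h.indep.indepFun (i := 1) (j := 2) (by decide)

theorem indepFun_sampling (h : IsRealization P s σ p U X W) :
    IndepFun (fun ω n => U n ω) (fun ω => ((fun n => X n ω), fun n => W n ω)) P :=
  (h.indep.indepFun_prodMk h.measurable_fun 1 2 0 (by decide) (by decide)).symm

theorem hasGaussianLaw_segment (h : IsRealization P s σ p U X W) (t : ℤ) (M : ℕ) :
    HasGaussianLaw (fun ω (n : Fin M) => X (t + n) ω + W (t + n) ω) P := by
  have hind : IndepFun (fun ω (n : Fin M) => X (t + n) ω) (fun ω (n : Fin M) => W (t + n) ω) P :=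
    h.indepFun_process_noise.comp (φ := fun (x : ℤ → ℝ) (n : Fin M) => x (t + n))
      (ψ := fun (x : ℤ → ℝ) (n : Fin M) => x (t + n)) (by fun_prop) (by fun_prop)
  exact iIndepFun.hasGaussianLaw_fun_add (h.process.hasGaussianLaw_segment t M)
    (h.noise.hasGaussianLaw_segment t M) hind

theorem integral_process_add_noise (h : IsRealization P s σ p U X W) (n : ℤ) :
    ∫ ω, X n ω + W n ω ∂P = 0 := by
  have := h.process.gaussian.isProbabilityMeasure
  rw [integral_add ((h.process.memLp_two n).integrable one_le_two)
    ((h.noise.memLp_two n).integrable one_le_two), h.process.mean_zero, h.noise.mean_zero, add_zero]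

theorem integral_mul_process_add_noise (h : IsRealization P s σ p U X W) (n k : ℤ) :
    ∫ ω, (X n ω + W n ω) * (X k ω + W k ω) ∂P = noisyACF s σ (n - k) := by
  have hX := h.process.memLp_two
  have hW := h.noise.memLp_two
  have hXW : ∀ n k, ∫ ω, X n ω * W k ω ∂P = 0 := by
    intro n k
    have hind : IndepFun (X n) (W k) P := h.indepFun_process_noise.comp
      (φ := fun x : ℤ → ℝ => x n) (ψ := fun x : ℤ → ℝ => x k) (by fun_prop) (by fun_prop)
    rw [hind.integral_fun_mul_eq_mul_integral (h.process.measurable n).aestronglyMeasurable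
      (h.noise.measurable k).aestronglyMeasurable, h.process.mean_zero, zero_mul]
  have h1 : ∀ ω, (X n ω + W n ω) * (X k ω + W k ω) =
      X n ω * X k ω + X n ω * W k ω + (X k ω * W n ω + W n ω * W k ω) := fun ω => by ring
  simp_rw [h1]
  have hXX : Integrable (fun ω => X n ω * X k ω) P := (hX n).integrable_mul (hX k)
  have hXW1 : Integrable (fun ω => X n ω * W k ω) P := (hX n).integrable_mul (hW k)
  have hXW2 : Integrable (fun ω => X k ω * W n ω) P := (hX k).integrable_mul (hW n)
  have hWW : Integrable (fun ω => W n ω * W k ω) P := (hW n).integrable_mul (hW k)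
  have h2 := integral_add (hXX.add hXW1) (hXW2.add hWW)
  simp only [Pi.add_apply] at h2
  rw [h2, integral_add hXX hXW1, integral_add hXW2 hWW, hXW, hXW, add_zero, zero_add, noisyACF]
  congr 1
  · rw [← h.process.integral_mul_eq, Complex.ofReal_re]
  · have := h.noise.integral_mul_eq n k
    split_ifs at this ⊢
    · exact_mod_cast this
    · exact_mod_cast this

theorem noisyACF_neg (h : IsRealization P s σ p U X W) (m : ℤ) :
    noisyACF s σ (-m) = noisyACF s σ m := by
  rw [noisyACF, noisyACF, h.process.apply_neg]
  simp only [neg_eq_zero]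

theorem abs_noisyACF_le (hs : IsNormalizedPSD s) (m : ℤ) :
    |noisyACF s σ m| ≤ 1 + (σ : ℝ) ^ 2 := by
  rw [noisyACF]
  refine (abs_add_le _ _).trans (add_le_add ?_ ?_)
  · exact (Complex.abs_re_le_norm _).trans (hs.norm_acf_le m)
  · split_ifs
    · rw [abs_of_nonneg (by positivity)]
    · simp only [abs_zero]; positivity

theorem noisyACF_zero (hs : IsNormalizedPSD s) : noisyACF s σ 0 = 1 + (σ : ℝ) ^ 2 := by
  simp [noisyACF, hs.acf_zero]

theorem sum_noisyACF_eq (s : ℝ → ℝ) (σ : ℝ≥0) {M : ℕ} (v : Fin M → ℝ) :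
    ∑ i : Fin M, ∑ j : Fin M, noisyACF s σ (i - j) * v i * v j =
      ∑ i : Fin M, ∑ j : Fin M, (acf s (i - j)).re * v i * v j + (σ : ℝ) ^ 2 * ∑ i, v i ^ 2 := by
  rw [Finset.mul_sum, ← Finset.sum_add_distrib]
  refine Finset.sum_congr rfl fun i _ => ?_
  have h1 : (σ : ℝ) ^ 2 * v i ^ 2 =
      ∑ j : Fin M, (if (i : ℤ) - j = 0 then (σ : ℝ) ^ 2 else 0) * v i * v j := by
    rw [Finset.sum_eq_single i]
    · simp; ring
    · intro j _ hj
      rw [if_neg, zero_mul, zero_mul]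
      intro h
      exact hj (Fin.ext (by omega))
    · simp
  rw [h1, ← Finset.sum_add_distrib]
  refine Finset.sum_congr rfl fun j _ => ?_
  rw [noisyACF]
  ring

variable [IsProbabilityMeasure P]

/-- Fluctuations of the empirical autocorrelation around its conditional mean given the sampling
pattern. -/
theorem measure_abs_empiricalACF_sub_sampling_ge_le (h : IsRealization P s σ p U X W)
    (hs : IsNormalizedPSD s) {B : ℝ} (hB : ∀ f ∈ Set.Ico (0 : ℝ) 1, s f ≤ B) {M : ℕ} (hM : 1 ≤ M)
    (t : ℤ) (m : ℕ) :
    P.real {ω | (4 * √2 * (B + (σ : ℝ) ^ 2) + 11 / 2 * (1 + (σ : ℝ) ^ 2)) * √(Real.log M / M) ≤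
      |empiricalACF (fun n : Fin M => U (t + n) ω * (X (t + n) ω + W (t + n) ω)) m -
        empiricalACF (fun n : Fin M => U (t + n) ω) m * noisyACF s σ m|} ≤ 2 / (M : ℝ) ^ 3 := by
  set τ := (4 * √2 * (B + (σ : ℝ) ^ 2) + 11 / 2 * (1 + (σ : ℝ) ^ 2)) * √(Real.log M / M) with hτ
  let u : Ω → Fin M → ℝ := fun ω n => U (t + n) ω
  let Y : Ω → Fin M → ℝ := fun ω n => X (t + n) ω + W (t + n) ω
  have hu : Measurable u := measurable_pi_lambda _ fun n => h.sampling.measurable _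
  have hY : Measurable Y := measurable_pi_lambda _ fun n =>
    (h.process.measurable _).add (h.noise.measurable _)
  have hlaw := h.hasGaussianLaw_segment t M
  have hgauss : IsGaussian (P.map Y) := hlaw.isGaussian_map
  have hind : IndepFun u Y P := h.indepFun_sampling.comp
    (φ := fun (x : ℤ → ℝ) (n : Fin M) => x (t + n))
    (ψ := fun (x : (ℤ → ℝ) × (ℤ → ℝ)) (n : Fin M) => x.1 (t + n) + x.2 (t + n)) (by fun_prop) (by fun_prop)
  let E : Set ((Fin M → ℝ) × (Fin M → ℝ)) :=
    {z | τ ≤ |empiricalACF (fun n => z.1 n * z.2 n) m - empiricalACF z.1 m * noisyACF s σ m|}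
  have hE : MeasurableSet E := by
    refine measurableSet_le measurable_const ?_
    simp only [empiricalACF, Int.natAbs_natCast]
    refine Measurable.abs (Measurable.sub ?_ ?_)
    · refine Measurable.const_mul (Finset.measurable_sum _ fun n _ => ?_) _
      split_ifs <;> fun_prop
    · refine Measurable.mul_const (Measurable.const_mul
        (Finset.measurable_sum _ fun n _ => ?_) _) _
      split_ifs <;> fun_prop
  have hset : {ω | τ ≤ |empiricalACF (fun n : Fin M => U (t + n) ω * (X (t + n) ω + W (t + n) ω)) m -
      empiricalACF (fun n : Fin M => U (t + n) ω) m * noisyACF s σ m|} =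
      (fun ω => (u ω, Y ω)) ⁻¹' E := rfl
  -- With the sampling pattern frozen at v, independence leaves the law of X + W unchanged, so the
  -- Gaussian bound holds for each section of E. Tonelli then integrates this uniform bound over the
  -- law of u.
  have hcond : ∀ v : Fin M → ℝ, (∀ i, |v i| ≤ 1) →
      (P.map Y).real (Prod.mk v ⁻¹' E) ≤ 2 / (M : ℝ) ^ 3 := by
    intro v hv
    have hcoe : ∀ m, acf s m = (((acf s m).re : ℝ) : ℂ) := h.process.eq_re
    have h0 := noisyACF_zero (σ := σ) hs
    have := measure_abs_empiricalACF_sub_ge_le hM (μ := P.map Y) (ρ := noisyACF s σ)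
      h.noisyACF_neg (S := B + (σ : ℝ) ^ 2) ?_ ?_ ?_ ?_ ?_ ?_ hv m
    · rw [h0] at this
      exact this
    · have := hs.one_le_of_le hB
      nlinarith [sq_nonneg (σ : ℝ)]
    · rw [h0]
      nlinarith [sq_nonneg (σ : ℝ)]
    · intro i
      rw [integral_map hY.aemeasurable (measurable_pi_apply i).aestronglyMeasurable]
      exact h.integral_process_add_noise _
    · intro i j
      rw [integral_map hY.aemeasurable (by fun_prop), h.integral_mul_process_add_noise]
      congr 1
      ring
    · intro w
      rw [sum_noisyACF_eq]
      have := sum_mul_acf_sub_nonneg hs hcoe (fun i : Fin M => (i : ℤ)) w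
      have : 0 ≤ ∑ i, w i ^ 2 := Finset.sum_nonneg fun i _ => sq_nonneg _
      positivity
    · intro w
      rw [sum_noisyACF_eq, add_mul]
      have := sum_mul_acf_sub_le hs hcoe (k := fun i : Fin M => (i : ℤ))
        (fun i j hij => Fin.ext (by simpa using hij)) w hB
      linarith
  have hae : ∀ᵐ v ∂(P.map u), ∀ i, |v i| ≤ 1 := by
    rw [ae_map_iff hu.aemeasurable
      (by simp only [Set.ofPred_forall]; exact MeasurableSet.iInter fun i => measurableSet_le (by fun_prop) (by fun_prop))]
    rw [ae_all_iff]
    intro i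
    filter_upwards [h.sampling.ae_eq_zero_or_one (t + i)] with ω hω
    rcases hω with hω | hω <;> simp [u, hω]
  have hprob : IsProbabilityMeasure (P.map u) := Measure.isProbabilityMeasure_map hu.aemeasurable
  rw [hset, measureReal_def]
  refine ENNReal.toReal_le_of_le_ofReal (by positivity) ?_
  rw [← Measure.map_apply (hu.prodMk hY) hE,
    (indepFun_iff_map_prod_eq_prod_map_map hu.aemeasurable hY.aemeasurable).1 hind,
    Measure.prod_apply hE]
  calc ∫⁻ v, (P.map Y) (Prod.mk v ⁻¹' E) ∂(P.map u)
      ≤ ∫⁻ _, ENNReal.ofReal (2 / (M : ℝ) ^ 3) ∂(P.map u) := by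
        refine lintegral_mono_ae ?_
        filter_upwards [hae] with v hv
        rw [← ofReal_measureReal]
        exact ENNReal.ofReal_le_ofReal (hcond v hv)
    _ = _ := by simp

theorem empiricalACF_eq_sum_range {M : ℕ} (y : ℕ → ℝ) (m : ℕ) :
    empiricalACF (fun n : Fin M => y n) m =
      1 / M * ∑ n ∈ Finset.range (M - m), y (n + m) * y n := by
  rw [empiricalACF]
  congr 1
  simp only [Int.natAbs_natCast, dite_eq_ite]
  rw [Fin.sum_univ_eq_sum_range (fun n => if n + m < M then y (n + m) * y n else 0),
    ← Finset.sum_filter]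
  congr 1
  ext n
  simp only [Finset.mem_filter, Finset.mem_range]
  omega

/-- The empirical autocorrelation at every lag is close to its mean, up to an event of probability
`6 / M²`. -/
theorem measure_exists_abs_empiricalACF_sub_gt_le (h : IsRealization P s σ p U X W)
    (hs : IsNormalizedPSD s) {B : ℝ} (hB : ∀ f ∈ Set.Ico (0 : ℝ) 1, s f ≤ B) {M : ℕ} (hM : 1 ≤ M)
    (t : ℤ) :
    P.real {ω | ∃ m < M, (4 * √2 * (B + (σ : ℝ) ^ 2) + 8 * (1 + (σ : ℝ) ^ 2)) *
        √(Real.log M / M) <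
      |empiricalACF (fun n : Fin M => U (t + n) ω * (X (t + n) ω + W (t + n) ω)) m -
        (1 - m / M) * (if m = 0 then p else p ^ 2) * noisyACF s σ m|} ≤ 6 / (M : ℝ) ^ 2 := by
  have hMR : (1 : ℝ) ≤ M := by exact_mod_cast hM
  set a := √(Real.log M / M) with ha
  set R := 1 + (σ : ℝ) ^ 2 with hR
  have hsq : √(M * Real.log M) = M * a := by
    rw [ha, ← Real.sqrt_sq (by linarith : (0 : ℝ) ≤ M), ← Real.sqrt_mul (sq_nonneg _),
      Real.sqrt_sq (by linarith : (0 : ℝ) ≤ M)]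
    congr 1
    field_simp
  let E1 : ℕ → Set Ω := fun m =>
    {ω | (4 * √2 * (B + (σ : ℝ) ^ 2) + 11 / 2 * R) * a ≤
      |empiricalACF (fun n : Fin M => U (t + n) ω * (X (t + n) ω + W (t + n) ω)) m -
        empiricalACF (fun n : Fin M => U (t + n) ω) m * noisyACF s σ m|}
  let E2 : ℕ → Set Ω := fun m =>
    {ω | 5 / 2 * √(M * Real.log M) < |∑ n ∈ Finset.range (M - m),
      (U (t + n + m) ω * U (t + n) ω - if m = 0 then p else p ^ 2)|}
  have hE : ∀ m, P.real (E1 m ∪ E2 m) ≤ 6 / (M : ℝ) ^ 3 := by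
    intro m
    refine (measureReal_union_le _ _).trans ?_
    have h1 := h.measure_abs_empiricalACF_sub_sampling_ge_le hs hB hM t m
    have h2 := h.sampling.measure_abs_sum_lag_gt_le t hM m
    have h3 : (6 : ℝ) / (M : ℝ) ^ 3 = 2 / (M : ℝ) ^ 3 + 4 / (M : ℝ) ^ 3 := by ring
    rw [h3]
    exact add_le_add h1 h2
  have hsub : {ω | ∃ m < M, (4 * √2 * (B + (σ : ℝ) ^ 2) + 8 * R) * a <
      |empiricalACF (fun n : Fin M => U (t + n) ω * (X (t + n) ω + W (t + n) ω)) m -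
        (1 - m / M) * (if m = 0 then p else p ^ 2) * noisyACF s σ m|} ⊆
      ⋃ m ∈ Finset.range M, (E1 m ∪ E2 m) := by
    rintro ω ⟨m, hm, hω⟩
    simp only [Set.mem_iUnion, Finset.mem_range]
    refine ⟨m, hm, ?_⟩
    by_contra hcon
    simp only [Set.mem_union, not_or] at hcon
    obtain ⟨h1, h2⟩ := hcon
    simp only [E1, E2, Set.mem_ofPred_eq, not_le, not_lt] at h1 h2
    set e := if m = 0 then p else p ^ 2
    -- Scaled by 1/M, the count deviation 5/2 √(M log M) becomes 5/2 a; multiplied by |ρ| ≤ R it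
    -- raises the constant 11/2 to 8.
    have h3 : |empiricalACF (fun n : Fin M => U (t + n) ω) m - (1 - m / M) * e| ≤ 5 / 2 * a := by
      have h4 : empiricalACF (fun n : Fin M => U (t + n) ω) m - (1 - m / M) * e =
          1 / M * ∑ n ∈ Finset.range (M - m), (U (t + n + m) ω * U (t + n) ω - e) := by
        rw [empiricalACF_eq_sum_range (fun n => U (t + n) ω), Finset.sum_sub_distrib,
          Finset.sum_const, Finset.card_range, nsmul_eq_mul, Nat.cast_sub hm.le]
        push_cast
        simp_rw [add_assoc]
        field_simp
      rw [h4, abs_mul, abs_of_nonneg (by positivity), div_mul_eq_mul_div, one_mul,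
        div_le_iff₀ (by linarith)]
      rw [hsq] at h2
      linarith
    have h5 : |empiricalACF (fun n : Fin M => U (t + n) ω) m * noisyACF s σ m -
        (1 - m / M) * e * noisyACF s σ m| ≤ 5 / 2 * a * R := by
      rw [← sub_mul, abs_mul]
      exact mul_le_mul h3 (abs_noisyACF_le hs _) (abs_nonneg _) (by positivity)
    have h6 := abs_sub_le
      (empiricalACF (fun n : Fin M => U (t + n) ω * (X (t + n) ω + W (t + n) ω)) m)
      (empiricalACF (fun n : Fin M => U (t + n) ω) m * noisyACF s σ m)
      ((1 - m / M) * e * noisyACF s σ m)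
    nlinarith
  calc _ ≤ P.real (⋃ m ∈ Finset.range M, (E1 m ∪ E2 m)) := measureReal_mono hsub (measure_ne_top _ _)
    _ ≤ ∑ m ∈ Finset.range M, P.real (E1 m ∪ E2 m) := measureReal_biUnion_finset_le _ _
    _ ≤ ∑ m ∈ Finset.range M, 6 / (M : ℝ) ^ 3 := Finset.sum_le_sum fun m _ => hE m
    _ = 6 / (M : ℝ) ^ 2 := by
      rw [Finset.sum_const, Finset.card_range, nsmul_eq_mul]
      field_simp

end IsRealization

/-! ### Windows -/

theorem mem_Icc_lag {M : ℕ} {m : ℤ} :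
    m ∈ Finset.Icc (-(M : ℤ) + 1) ((M : ℤ) - 1) ↔ |m| < M := by
  rw [Finset.mem_Icc, abs_lt]
  omega

theorem natAbs_lt_of_mem_Icc_lag {M : ℕ} {m : ℤ}
    (hm : m ∈ Finset.Icc (-(M : ℤ) + 1) ((M : ℤ) - 1)) : m.natAbs < M := by
  rw [Finset.mem_Icc] at hm
  omega

namespace IsWindow

variable {M : ℕ} {A : ℝ} {g : ℤ → ℝ}

/-- An empty support would contradict g[0] = 1; this supplies M ≥ 1 in the main theorem. -/
theorem one_le_length (hg : IsWindow M A g) : 1 ≤ M := by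
  by_contra h
  have h0 := hg.support 0 (by simp; omega)
  rw [hg.zero] at h0
  exact one_ne_zero h0

theorem dtft_eq_sum (hg : IsWindow M A g) (f : ℝ) :
    dtft g f = ∑ m ∈ Finset.Icc (-(M : ℤ) + 1) ((M : ℤ) - 1), (g m : ℂ) * expi (-m) f := by
  simp only [dtft, exp_neg_eq_expi]
  refine tsum_eq_sum fun m hm => ?_
  rw [mem_Icc_lag, not_lt] at hm
  simp [hg.support m hm]

theorem dtft_eq_re (hg : IsWindow M A g) (f : ℝ) : dtft g f = ((dtft g f).re : ℂ) := by
  refine (Complex.conj_eq_iff_re.1 ?_).symm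
  rw [hg.dtft_eq_sum, map_sum]
  refine Finset.sum_equiv (Equiv.neg ℤ) (fun m => ?_) fun m _ => ?_
  · rw [mem_Icc_lag, mem_Icc_lag, Equiv.neg_apply, abs_neg]
  · rw [map_mul, conj_expi, Complex.conj_ofReal, Equiv.neg_apply, hg.even]

theorem continuous_dtft (hg : IsWindow M A g) : Continuous (dtft g) := by
  have : dtft g = _ := funext hg.dtft_eq_sum
  rw [this]
  fun_prop

theorem integral_dtft_re (hg : IsWindow M A g) : ∫ f in (0 : ℝ)..1, (dtft g f).re = 1 := by
  have h1 : ((∫ f in (0 : ℝ)..1, (dtft g f).re : ℝ) : ℂ) = 1 := by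
    rw [← intervalIntegral.integral_ofReal]
    simp_rw [← hg.dtft_eq_re, hg.dtft_eq_sum]
    rw [intervalIntegral.integral_finsetSum fun m _ => by
      apply Continuous.intervalIntegrable; fun_prop]
    simp_rw [intervalIntegral.integral_const_mul, integral_expi, neg_eq_zero]
    rw [Finset.sum_eq_single 0]
    · simp [hg.zero]
    · intro m _ hm
      simp [hm]
    · intro h
      have := hg.one_le_length
      exact absurd (mem_Icc_lag.2 (by simp; omega)) h
  exact_mod_cast h1

/-- The transform has mean g[0] = 1 over the unit interval. The bound later allows √A to be replaced
by A. -/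
theorem one_le_bound (hg : IsWindow M A g) : 1 ≤ A := by
  have : ∫ _ in (0 : ℝ)..1, A = A := by simp
  refine hg.integral_dtft_re.ge.trans (le_of_le_of_eq ?_ this)
  exact intervalIntegral.integral_mono_on_of_le_Ioo zero_le_one
    ((Complex.continuous_re.comp hg.continuous_dtft).intervalIntegrable _ _)
    intervalIntegrable_const fun f hf => hg.dtft_le f ⟨hf.1.le, hf.2⟩

/-- Parseval, then 0 ≤ g(f) ≤ A: ∫ g(f)² ≤ A ∫ g(f) = A g[0] = A. -/
theorem sum_sq_le (hg : IsWindow M A g) :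
    ∑ m ∈ Finset.Icc (-(M : ℤ) + 1) ((M : ℤ) - 1), g m ^ 2 ≤ A := by
  have hpars := integral_norm_sq_sum_expi (Finset.Icc (-(M : ℤ) + 1) ((M : ℤ) - 1))
    (fun m => -m) neg_injective.injOn fun m => (g m : ℂ)
  simp only [Complex.norm_real, Real.norm_eq_abs, sq_abs, ← hg.dtft_eq_sum] at hpars
  have hA : A * ∫ f in (0 : ℝ)..1, (dtft g f).re = A := by rw [hg.integral_dtft_re, mul_one]
  rw [← hpars]
  refine le_of_le_of_eq ?_ hA
  rw [← intervalIntegral.integral_const_mul]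
  have hcont := hg.continuous_dtft
  refine intervalIntegral.integral_mono_on_of_le_Ioo zero_le_one ?_ ?_ fun f hf => ?_
  · exact Continuous.intervalIntegrable (by fun_prop) _ _
  · exact (continuous_const.mul (Complex.continuous_re.comp hcont)).intervalIntegrable _ _
  · have hf' : f ∈ Set.Ico (0 : ℝ) 1 := ⟨hf.1.le, hf.2⟩
    rw [hg.dtft_eq_re, Complex.norm_real, Real.norm_eq_abs, sq_abs, Complex.ofReal_re, sq]
    exact mul_le_mul_of_nonneg_right (hg.dtft_le f hf') (hg.dtft_nonneg f hf')

end IsWindow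

/-! ### Error of the Blackman–Tukey estimate -/

theorem integral_le_sqrt_integral_sq {φ : ℝ → ℝ} (hφ : Continuous φ) :
    ∫ f in (0 : ℝ)..1, φ f ≤ √(∫ f in (0 : ℝ)..1, φ f ^ 2) := by
  refine Real.le_sqrt_of_sq_le ?_
  set c := ∫ f in (0 : ℝ)..1, φ f
  have h0 : 0 ≤ ∫ f in (0 : ℝ)..1, (φ f - c) ^ 2 :=
    intervalIntegral.integral_nonneg zero_le_one fun f _ => sq_nonneg _
  have h1 : ∫ f in (0 : ℝ)..1, (φ f - c) ^ 2 = (∫ f in (0 : ℝ)..1, φ f ^ 2) - c ^ 2 := by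
    have : ∀ f, (φ f - c) ^ 2 = φ f ^ 2 - (2 * c * φ f - c ^ 2) := fun f => by ring
    simp_rw [this]
    rw [intervalIntegral.integral_sub, intervalIntegral.integral_sub,
      intervalIntegral.integral_const_mul]
    · simp only [intervalIntegral.integral_const, sub_zero, smul_eq_mul, one_mul]
      change _ - (2 * c * c - c ^ 2) = _
      ring
    all_goals exact Continuous.intervalIntegrable (by fun_prop) _ _
  linarith

theorem blackmanTukey_eq_sum_expi {M : ℕ} (w : ℤ → ℝ) (x : Fin M → ℝ) (f : ℝ) :
    blackmanTukey w x f = ∑ m ∈ Finset.Icc (-(M : ℤ) + 1) ((M : ℤ) - 1),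
      ((w m * empiricalACF x m : ℝ) : ℂ) * expi (-m) f := by
  simp only [blackmanTukey, exp_neg_eq_expi, Complex.ofReal_mul]

theorem continuous_blackmanTukey {M : ℕ} (w : ℤ → ℝ) (x : Fin M → ℝ) :
    Continuous (blackmanTukey w x) := by
  have : blackmanTukey w x = _ := funext (blackmanTukey_eq_sum_expi w x)
  rw [this]
  fun_prop

theorem empiricalACF_natAbs {M : ℕ} (x : Fin M → ℝ) (m : ℤ) :
    empiricalACF x m.natAbs = empiricalACF x m := by
  simp only [empiricalACF, Int.natAbs_natCast]

/-- The total moment `∑ₘ |h[m]| |r[m]|` of a spectral density. -/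
noncomputable def psdMoment (M : ℕ) (g : ℤ → ℝ) (s : ℝ → ℝ) : ℝ :=
  ∑' m : ℤ, |momentWeight M g m| * ‖acf s m‖

section Bias

variable {M : ℕ} {A : ℝ} {g : ℤ → ℝ} {s : ℝ → ℝ}

theorem summable_psdMoment (hs : IsNormalizedPSD s) (g : ℤ → ℝ) (M : ℕ) :
    Summable fun m : ℤ => |momentWeight M g m| * ‖acf s m‖ := by
  refine hs.summable_acf.congr_cofinite ?_
  have hfin : Set.Finite {m : ℤ | ¬ ‖acf s m‖ = |momentWeight M g m| * ‖acf s m‖} := by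
    refine (Finset.Icc (-(M : ℤ) + 1) ((M : ℤ) - 1)).finite_toSet.subset fun m hm => ?_
    rw [Finset.mem_coe, mem_Icc_lag]
    by_contra h
    exact hm (by simp [momentWeight, h])
  exact hfin

/-- The bias of the windowed and tapered autocorrelation is controlled by the moment. -/
theorem norm_sum_window_mul_acf_sub_le (hs : IsNormalizedPSD s) (g : ℤ → ℝ) (M : ℕ) {f : ℝ}
    (hf : f ∈ Set.Ioo (0 : ℝ) 1) :
    ‖∑ m ∈ Finset.Icc (-(M : ℤ) + 1) ((M : ℤ) - 1),
      ((g m * (1 - |(m : ℝ)| / M) : ℝ) : ℂ) * acf s m * expi (-m) f - s f‖ ≤ psdMoment M g s := by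
  -- From lag M on, h = 1 and the factor 1 − h vanishes, so the finite sum is a series over ℤ that
  -- can be subtracted termwise from the Fourier series of s.
  have hfin : HasSum (fun m : ℤ => ((1 - momentWeight M g m : ℝ) : ℂ) * (acf s m * expi (-m) f))
      (∑ m ∈ Finset.Icc (-(M : ℤ) + 1) ((M : ℤ) - 1),
        ((g m * (1 - |(m : ℝ)| / M) : ℝ) : ℂ) * acf s m * expi (-m) f) := by
    have h1 : ∑ m ∈ Finset.Icc (-(M : ℤ) + 1) ((M : ℤ) - 1),
        ((g m * (1 - |(m : ℝ)| / M) : ℝ) : ℂ) * acf s m * expi (-m) f =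
        ∑ m ∈ Finset.Icc (-(M : ℤ) + 1) ((M : ℤ) - 1),
          ((1 - momentWeight M g m : ℝ) : ℂ) * (acf s m * expi (-m) f) := by
      refine Finset.sum_congr rfl fun m hm => ?_
      rw [mem_Icc_lag] at hm
      rw [momentWeight, if_pos hm, sub_sub_cancel, mul_assoc]
    rw [h1]
    refine hasSum_sum_of_ne_finset_zero fun m hm => ?_
    rw [mem_Icc_lag] at hm
    simp [momentWeight, hm]
  have hsub := (hs.summable_acf_mul_expi f).hasSum.sub hfin
  have hnorm : ∀ m : ℤ, ‖acf s m * expi (-m) f -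
      ((1 - momentWeight M g m : ℝ) : ℂ) * (acf s m * expi (-m) f)‖ =
      |momentWeight M g m| * ‖acf s m‖ := by
    intro m
    have : acf s m * expi (-m) f - ((1 - momentWeight M g m : ℝ) : ℂ) * (acf s m * expi (-m) f) =
        (momentWeight M g m : ℂ) * (acf s m * expi (-m) f) := by
      push_cast; ring
    rw [this, norm_mul, norm_mul, norm_expi, mul_one, Complex.norm_real, Real.norm_eq_abs]
  rw [norm_sub_rev, hs.eq_tsum hf, ← hsub.tsum_eq]
  refine (norm_tsum_le_tsum_norm ?_).trans (le_of_eq ?_)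
  · simpa only [hnorm] using summable_psdMoment hs g M
  · simp only [hnorm, psdMoment]

theorem integral_norm_blackmanTukey_sub_le (hg : IsWindow M A g) (hs : IsNormalizedPSD s)
    {σ : ℝ≥0} {p : ℝ} (hp : 0 < p) (hp1 : p ≤ 1) (hre : ∀ m, acf s m = ((acf s m).re : ℂ))
    (heven : ∀ m, noisyACF s σ (-m) = noisyACF s σ m) {x : Fin M → ℝ} {D : ℝ}
    (hD : ∀ m < M, |empiricalACF x m -
      (1 - m / M) * (if m = 0 then p else p ^ 2) * noisyACF s σ m| ≤ D) :
    ∫ f in (0 : ℝ)..1, ‖blackmanTukey (correctedWindow p g) x f - ((s f + (σ : ℝ) ^ 2 : ℝ) : ℂ)‖ ≤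
      A * D / p ^ 2 + psdMoment M g s := by
  set F := Finset.Icc (-(M : ℤ) + 1) ((M : ℤ) - 1) with hF
  set w := correctedWindow p g
  have hM := hg.one_le_length
  have hD0 : 0 ≤ D := (abs_nonneg _).trans (hD 0 (by omega))
  have hA := hg.one_le_bound
  have h0F : (0 : ℤ) ∈ F := mem_Icc_lag.2 (by simp; omega)
  let e : ℤ → ℝ := fun m => if m = 0 then p else p ^ 2
  let dev : ℤ → ℝ := fun m => empiricalACF x m - (1 - |(m : ℝ)| / M) * e m * noisyACF s σ m
  have he : ∀ m, p ^ 2 ≤ e m := fun m => by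
    simp only [e]
    split_ifs
    · nlinarith
    · exact le_rfl
  have he0 : ∀ m, 0 < e m := fun m => lt_of_lt_of_le (by positivity) (he m)
  have hw : ∀ m, w m = g m / e m := fun m => rfl
  have hdev : ∀ m ∈ F, |dev m| ≤ D := by
    intro m hm
    have h1 := hD m.natAbs (natAbs_lt_of_mem_Icc_lag hm)
    rw [empiricalACF_natAbs] at h1
    have h2 : noisyACF s σ (m.natAbs : ℤ) = noisyACF s σ m := by
      rcases Int.natAbs_eq m with h | h
      · rw [← h]
      · conv_rhs => rw [h, heven]
    rw [h2, Nat.cast_natAbs] at h1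
    simpa only [dev, e, Int.natAbs_eq_zero, Int.cast_abs] using h1
  let T : ℝ → ℂ := fun f => ∑ m ∈ F, ((w m * dev m : ℝ) : ℂ) * expi (-m) f
  have hT : Continuous T := by fun_prop
  -- Dividing the window by e[m] cancels the sampling mean exactly. White noise enters at lag 0
  -- only, where window and taper equal 1, so it contributes the constant σ² and no bias.
  have hdecomp : ∀ f, blackmanTukey w x f - ((s f + (σ : ℝ) ^ 2 : ℝ) : ℂ) =
      T f + (∑ m ∈ F, ((g m * (1 - |(m : ℝ)| / M) : ℝ) : ℂ) * acf s m * expi (-m) f - s f) := by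
    intro f
    have h1 : ((σ : ℝ) ^ 2 : ℂ) = ∑ m ∈ F, (g m : ℂ) * ((1 - |(m : ℝ)| / M : ℝ) : ℂ) *
        (if m = 0 then ((σ : ℝ) ^ 2 : ℂ) else 0) * expi (-m) f := by
      rw [Finset.sum_eq_single 0]
      · simp [hg.zero]
      · intro m _ hm
        simp [hm]
      · exact fun h => absurd h0F h
    have h2 : blackmanTukey w x f = T f +
        (∑ m ∈ F, ((g m * (1 - |(m : ℝ)| / M) : ℝ) : ℂ) * acf s m * expi (-m) f +
        ∑ m ∈ F, (g m : ℂ) * ((1 - |(m : ℝ)| / M : ℝ) : ℂ) *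
        (if m = 0 then ((σ : ℝ) ^ 2 : ℂ) else 0) * expi (-m) f) := by
      rw [blackmanTukey_eq_sum_expi, ← Finset.sum_add_distrib, ← Finset.sum_add_distrib]
      refine Finset.sum_congr rfl fun m _ => ?_
      have h3 : w m * empiricalACF x m = w m * dev m +
          g m * (1 - |(m : ℝ)| / M) * noisyACF s σ m := by
        have := (he0 m).ne'
        simp only [dev, hw]
        field_simp
        ring
      have h4 : (noisyACF s σ m : ℂ) = acf s m + if m = 0 then ((σ : ℝ) ^ 2 : ℂ) else 0 := by
        rw [noisyACF, hre m]
        split_ifs <;> simp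
      rw [h3, Complex.ofReal_add, Complex.ofReal_mul (g m * _), h4]
      push_cast
      ring
    rw [h2, ← h1]
    push_cast
    ring
  have hTint : ∫ f in (0 : ℝ)..1, ‖T f‖ ≤ A * D / p ^ 2 := by
    refine (integral_le_sqrt_integral_sq hT.norm).trans ?_
    rw [integral_norm_sq_sum_expi F (fun m => -m) neg_injective.injOn]
    refine Real.sqrt_le_iff.2 ⟨by positivity, ?_⟩
    calc ∑ m ∈ F, ‖((w m * dev m : ℝ) : ℂ)‖ ^ 2
        ≤ ∑ m ∈ F, (D / p ^ 2) ^ 2 * g m ^ 2 := by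
          refine Finset.sum_le_sum fun m hm => ?_
          rw [Complex.norm_real, Real.norm_eq_abs, abs_mul, hw, abs_div, abs_of_pos (he0 m),
            ← sq_abs (g m), ← mul_pow]
          have h1 : |g m| / e m * |dev m| ≤ |g m| / p ^ 2 * D := by
            gcongr
            · exact he m
            · exact hdev m hm
          calc (|g m| / e m * |dev m|) ^ 2 ≤ (|g m| / p ^ 2 * D) ^ 2 := by
                have := (he0 m).le
                gcongr
            _ = _ := by ring
      _ = (D / p ^ 2) ^ 2 * ∑ m ∈ F, g m ^ 2 := by rw [Finset.mul_sum]
      _ ≤ (D / p ^ 2) ^ 2 * A := by gcongr; exact hg.sum_sq_le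
      _ ≤ (D / p ^ 2) ^ 2 * A ^ 2 := by gcongr; nlinarith
      _ = (A * D / p ^ 2) ^ 2 := by ring
  have hsI := hs.intervalIntegrable_ofReal
  calc ∫ f in (0 : ℝ)..1, ‖blackmanTukey w x f - ((s f + (σ : ℝ) ^ 2 : ℝ) : ℂ)‖
      ≤ ∫ f in (0 : ℝ)..1, (‖T f‖ + psdMoment M g s) := by
        refine intervalIntegral.integral_mono_on_of_le_Ioo zero_le_one ?_ ?_ fun f hf => ?_
        · push_cast
          exact (((continuous_blackmanTukey w x).intervalIntegrable _ _).sub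
            (hsI.add intervalIntegrable_const)).norm
        · exact Continuous.intervalIntegrable (by fun_prop) _ _
        · rw [hdecomp]
          exact (norm_add_le _ _).trans
            (add_le_add le_rfl (norm_sum_window_mul_acf_sub_le hs g M hf))
    _ = (∫ f in (0 : ℝ)..1, ‖T f‖) + psdMoment M g s := by
        rw [intervalIntegral.integral_add (hT.norm.intervalIntegrable _ _)
          intervalIntegrable_const]
        simp
    _ ≤ _ := by gcongr

end Bias

/-! ### Distances between estimates and between models -/

theorem obsDist_le_of_same_model {M : ℕ} {w : ℤ → ℝ} {x y : Fin M → ℝ} {b : ℝ → ℝ}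
    (hb : IntervalIntegrable b volume 0 1) {η : ℝ}
    (hx : ∫ f in (0 : ℝ)..1, ‖blackmanTukey w x f - (b f : ℂ)‖ ≤ η)
    (hy : ∫ f in (0 : ℝ)..1, ‖blackmanTukey w y f - (b f : ℂ)‖ ≤ η) :
    obsDist w x y ≤ η := by
  have hbI : IntervalIntegrable (fun f => (b f : ℂ)) volume 0 1 := ⟨hb.1.ofReal, hb.2.ofReal⟩
  have hxI := (((continuous_blackmanTukey w x).intervalIntegrable 0 1).sub hbI).norm
  have hyI := (((continuous_blackmanTukey w y).intervalIntegrable 0 1).sub hbI).norm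
  have h1 : ∫ f in (0 : ℝ)..1, ‖blackmanTukey w x f - blackmanTukey w y f‖ ≤
      (∫ f in (0 : ℝ)..1, ‖blackmanTukey w x f - (b f : ℂ)‖) +
      ∫ f in (0 : ℝ)..1, ‖blackmanTukey w y f - (b f : ℂ)‖ := by
    rw [← intervalIntegral.integral_add hxI hyI]
    refine intervalIntegral.integral_mono_on zero_le_one ?_ (hxI.add hyI) fun f _ => ?_
    · exact (((continuous_blackmanTukey w x).sub
        (continuous_blackmanTukey w y)).norm).intervalIntegrable _ _
    · rw [norm_sub_rev (blackmanTukey w y f)]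
      exact norm_sub_le_norm_sub_add_norm_sub _ _ _
  rw [obsDist]
  linarith

/-- The constant c stands for the noise level σ²: it shifts both densities and cancels in their
difference. Two errors η, halved by the definition of the distances, cost η in total. -/
theorem psdDist_le_obsDist_add {M : ℕ} {w : ℤ → ℝ} {x y : Fin M → ℝ} {b b' : ℝ → ℝ} (c : ℝ)
    (hb : IntervalIntegrable b volume 0 1) (hb' : IntervalIntegrable b' volume 0 1) {η : ℝ}
    (hx : ∫ f in (0 : ℝ)..1, ‖blackmanTukey w x f - ((b f + c : ℝ) : ℂ)‖ ≤ η)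
    (hy : ∫ f in (0 : ℝ)..1, ‖blackmanTukey w y f - ((b' f + c : ℝ) : ℂ)‖ ≤ η) :
    psdDist b b' ≤ obsDist w x y + η := by
  have hI : ∀ {b : ℝ → ℝ} (z : Fin M → ℝ), IntervalIntegrable b volume 0 1 →
      IntervalIntegrable (fun f => ‖blackmanTukey w z f - ((b f + c : ℝ) : ℂ)‖) volume 0 1 := by
    intro b z hb
    have hbI : IntervalIntegrable (fun f => ((b f + c : ℝ) : ℂ)) volume 0 1 :=
      ⟨(hb.add intervalIntegrable_const).1.ofReal, (hb.add intervalIntegrable_const).2.ofReal⟩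
    exact (((continuous_blackmanTukey w z).intervalIntegrable 0 1).sub hbI).norm
  have hxI := hI x hb
  have hyI := hI y hb'
  have hxy : IntervalIntegrable (fun f => ‖blackmanTukey w x f - blackmanTukey w y f‖)
      volume 0 1 := (((continuous_blackmanTukey w x).sub
        (continuous_blackmanTukey w y)).norm).intervalIntegrable _ _
  have h1 : ∫ f in (0 : ℝ)..1, |b f - b' f| ≤
      ((∫ f in (0 : ℝ)..1, ‖blackmanTukey w x f - ((b f + c : ℝ) : ℂ)‖) +
      ∫ f in (0 : ℝ)..1, ‖blackmanTukey w x f - blackmanTukey w y f‖) +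
      ∫ f in (0 : ℝ)..1, ‖blackmanTukey w y f - ((b' f + c : ℝ) : ℂ)‖ := by
    rw [← intervalIntegral.integral_add hxI hxy,
      ← intervalIntegral.integral_add (hxI.add hxy) hyI]
    refine intervalIntegral.integral_mono_on zero_le_one (hb.sub hb').abs
      ((hxI.add hxy).add hyI) fun f _ => ?_
    have h2 : |b f - b' f| = ‖((b f + c : ℝ) : ℂ) - ((b' f + c : ℝ) : ℂ)‖ := by
      rw [← Complex.ofReal_sub, Complex.norm_real, Real.norm_eq_abs, add_sub_add_right_eq_sub]
    rw [h2, norm_sub_rev (blackmanTukey w x f) ((b f + c : ℝ) : ℂ)]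
    refine (norm_sub_le_norm_sub_add_norm_sub _ (blackmanTukey w y f) _).trans ?_
    gcongr
    exact norm_sub_le_norm_sub_add_norm_sub _ _ _
  rw [psdDist, obsDist]
  linarith

end ProcessClustering

open ProcessClustering in
theorem theorem2 {Ω : Type*} [MeasurableSpace Ω] (P : Measure Ω) [IsProbabilityMeasure P]
    (L N M : ℕ) [NeZero L] [NeZero N]
    (s : Fin L → ℝ → ℝ) (hs : ∀ l, ProcessClustering.IsNormalizedPSD (s l))
    (σ : ℝ≥0) (p : ℝ) (hp : 0 < p)
    (g : ℤ → ℝ) (A : ℝ) (hg : ProcessClustering.IsWindow M A g)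
    (label : Fin N → Fin L) (hlabel : Function.Surjective label)
    (x : Fin N → Ω → Fin M → ℝ)
    (hx : ∀ i, ProcessClustering.IsObservation P (s (label i)) σ p (x i))
    (hcond : ProcessClustering.ClusteringCondition M g A s σ p) :
    1 - 6 * (N : ℝ) / (M : ℝ) ^ 2 ≤
      P.real {ω | ProcessClustering.KMSucceeds
        (fun i j => ProcessClustering.obsDist (ProcessClustering.correctedWindow p g)
          (x i ω) (x j ω)) label} := by
  have hM := hg.one_le_length
  have hA := hg.one_le_bound
  set a := √(Real.log M / M) with ha
  have ha0 : 0 ≤ a := Real.sqrt_nonneg _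
  set B := maxPSD s with hB
  set D := (4 * √2 * (B + (σ : ℝ) ^ 2) + 8 * (1 + (σ : ℝ) ^ 2)) * a with hD
  set μ := maxMoment M g s with hμ
  let bad : Fin N → Set Ω := fun i => {ω | ∃ m < M, D < |empiricalACF (x i ω) m -
    (1 - m / M) * (if m = 0 then p else p ^ 2) * noisyACF (s (label i)) σ m|}
  have hbad : ∀ i, P.real (bad i) ≤ 6 / (M : ℝ) ^ 2 := by
    intro i
    obtain ⟨U, X, W, h, t, hxi⟩ := hx i
    have hfun : ∀ ω, x i ω = fun n : Fin M => U (t + n) ω * (X (t + n) ω + W (t + n) ω) :=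
      fun ω => funext (hxi ω)
    simp only [bad, hfun]
    exact h.measure_exists_abs_empiricalACF_sub_gt_le (hs _) (fun f hf => le_maxPSD hs _ hf) hM t
  have hp1 : p ≤ 1 := by
    obtain ⟨U, X, W, h, -⟩ := hx 0
    exact h.sampling.prob_le_one
  have hmom : ∀ l, psdMoment M g (s l) ≤ μ := fun l =>
    le_ciSup (f := fun l => psdMoment M g (s l)) (Set.finite_range _).bddAbove l
  have herr : ∀ ω, (∀ i, ω ∉ bad i) → ∀ i,
      ∫ f in (0 : ℝ)..1, ‖blackmanTukey (correctedWindow p g) (x i ω) f -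
        ((s (label i) f + (σ : ℝ) ^ 2 : ℝ) : ℂ)‖ ≤ A * D / p ^ 2 + μ := by
    intro ω hω i
    obtain ⟨U, X, W, h, -⟩ := hx i
    refine (integral_norm_blackmanTukey_sub_le hg (hs (label i)) hp hp1 h.process.eq_re
      h.noisyACF_neg (D := D) fun m hm => ?_).trans (by gcongr; exact hmom _)
    by_contra! hcon
    exact hω i ⟨m, hm, hcon⟩
  -- Here 8√2 · √2 (1 + p) = 16 (1 + p), while 2D only needs 16; the assumed separation has slack 16
  -- A p (1 + σ²) a / p².
  have hthresh : 2 * (A * D / p ^ 2) ≤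
      8 * √2 * A * (B + (σ : ℝ) ^ 2 + √2 * (1 + p) * (1 + (σ : ℝ) ^ 2)) / p ^ 2 * a := by
    have h1 : 8 * √2 * A * (B + (σ : ℝ) ^ 2 + √2 * (1 + p) * (1 + (σ : ℝ) ^ 2)) / p ^ 2 * a =
        2 * (A * D / p ^ 2) + 16 * (A * p * (1 + (σ : ℝ) ^ 2) * a / p ^ 2) := by
      have h2 : √2 * √2 = 2 := Real.mul_self_sqrt (by norm_num)
      rw [hD]
      field_simp
      linear_combination 8 * a * (1 + p) * (1 + (σ : ℝ) ^ 2) * h2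
    rw [h1]
    have : 0 ≤ A * p * (1 + (σ : ℝ) ^ 2) * a / p ^ 2 := by positivity
    linarith
  have hgood : ∀ ω, (∀ i, ω ∉ bad i) →
      KMSucceeds (fun i j => obsDist (correctedWindow p g) (x i ω) (x j ω)) label := by
    intro ω hω
    refine kmSucceeds_of_separated hlabel (τ := A * D / p ^ 2 + μ) (fun i j hij => ?_)
      fun i j hij => ?_
    · have hj := herr ω hω j
      rw [← hij] at hj
      exact obsDist_le_of_same_model ((hs (label i)).intervalIntegrable.add
        intervalIntegrable_const) (herr ω hω i) hj
    · have h1 := psdDist_le_obsDist_add ((σ : ℝ) ^ 2) (hs (label i)).intervalIntegrable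
        (hs (label j)).intervalIntegrable (herr ω hω i) (herr ω hω j)
      have h2 := hcond _ _ hij
      linarith
  set good := {ω | KMSucceeds (fun i j => obsDist (correctedWindow p g) (x i ω) (x j ω)) label}
  have hcompl : P.real goodᶜ ≤ 6 * (N : ℝ) / (M : ℝ) ^ 2 := by
    calc P.real goodᶜ ≤ P.real (⋃ i, bad i) := by
          refine measureReal_mono fun ω hω => ?_
          by_contra hcon
          exact hω (hgood ω fun i hi => hcon (Set.mem_iUnion.2 ⟨i, hi⟩))
      _ ≤ ∑ i, P.real (bad i) := measureReal_iUnion_fintype_le _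
      _ ≤ ∑ _i : Fin N, 6 / (M : ℝ) ^ 2 := Finset.sum_le_sum fun i _ => hbad i
      _ = _ := by
          rw [Finset.sum_const, Finset.card_univ, Fintype.card_fin, nsmul_eq_mul]
          ring
  -- Subadditivity is enough, which avoids proving that the success event is measurable.
  have htotal : (1 : ℝ) ≤ P.real good + P.real goodᶜ := by
    rw [← probReal_univ (μ := P), ← Set.union_compl_self good]
    exact measureReal_union_le _ _
  linarith
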